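/- **Setting.** A Polish structure is a pair $(X,G)$ where $G$ is a Polish group acting faithfully on a set $X$ with closed point stabilizers; it is a *small compact $G$-space* if moreover $X$ is a compact Hausdorff space, the action is continuous, and for every $n$ there are only countably many $G$-orbits on $X^n$. The imaginary extension $X^{eq}$ is the disjoint union of all quotients $X^n/E$, where $E$ is a $G$-invariant equivalence relation on $X^n$ all of whose classes have closed stabilizers in $G$. A topological sort is a quotient $X^n/E$, with the quotient topology, where $E$ is a closed $G$-invariant equivalence relation on $X^n$; $X^{teq}$ is the disjoint union of the topological sorts. For a finite set $P\subseteq X^{eq}$ of parameters let $G_P$ be its pointwise stabilizer. A subset of a topological sort (or of a finite power of one) is *$P$-closed* if it is closed and $G_P$-invariant, and *$*$-closed* if it is $P$-closed for some finite $P\subseteq X^{eq}$. A group $H$ whose underlying set is a subset of a topological sort is called $P$-closed ($*$-closed, respectively) if both the set $H$ and the graph of its multiplication are $P$-closed ($*$-closed, respectively). Let $H$ be a $*$-closed group in $X^{teq}$. A subgroup $A\le H$ is *minimal* if it is infinite, $*$-closed, and every $*$-closed subgroup of infinite index in $A$ is finite. If $A$ is an abelian minimal subgroup, a *virtual autogeny*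 of $A$ is a $*$-closed isomorphism $f\colon D/K\to I/C$, where $D,I$ are open subgroups of $A$ and $K\le D$, $C\le I$ are finite subgroups; it is identified with its graph $\{(x,y)\in D\times I: f(xK)=yC\}\le A\times A$. Two virtual autogenies $f_1,f_2$ are equivalent, $f_1\sim f_2$, if their graphs are commensurable subgroups of $A\times A$. The $\sim$-classes of virtual autogenies are the nonzero elements of a division ring $R$, whose operations are induced by pointwise addition and by composition of graphs, and whose zero is the class of the zero map. **Lemma.** Let $(X,G)$ be a small compact $G$-space, $H$ a $*$-closed group in $X^{teq}$, $A$ an abelian minimal subgroup of $H$, and $R$ the division ring of virtual autogenies of $A$ modulo $\sim$. Then: 1. $R$ is locally finite: every subring of $R$ generated by a finite set is finite. 2. Let $P\subseteq X^{eq}$ be finite such that the group $H$ and the set $A$ are $P$-closed. Let $a$ be a finite tuple of elements of $X$ and $f_a$ a virtual autogeny of $A$ whose graph is $a$-closed. For $x=ga$ with $g\in G$ put $f_x:=g[f_a]$ (this does not depend on the choice of $g$). Then, for $x$ in the orbit $o(a/P)=G_P\,a$, $f_x$ is a virtual autogeny of $A$, and the equivalence relation $E(x,y)$ on $o(a/P)$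 given by $f_x\sim f_y$ has only finitely many classes. -/

import Mathlib

open scoped Pointwise

/-! ## Quasi-endomorphisms of an abelian group

A quasi-endomorphism of an abelian group `A` (written multiplicatively) is an additive relation,
i.e. a subgroup of `A × A`, whose domain has finite index and whose indeterminacy
`{y | (1, y) ∈ Γ}` is finite.  Two of them are identified when they are commensurable. -/

section QuasiEndomorphisms

variable {A : Type*} [CommGroup A]

/-- `Γ ≤ A × A` is the graph of a multivalued homomorphism defined on a subgroup of finite index,
with finite indeterminacy. -/
structure IsQuasiEnd (Γ : Subgroup (A × A)) : Prop where
  dom : (Γ.map (MonoidHom.fst A A)).FiniteIndex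
  indet : {y : A | ((1 : A), y) ∈ Γ}.Finite

variable (A) in
/-- Quasi-endomorphisms, as graphs. -/
def QuasiEnd : Type _ := {Γ : Subgroup (A × A) // IsQuasiEnd Γ}

/-- Composition of relations, `Γ` after `Δ`. -/
def relComp (Γ Δ : Subgroup (A × A)) : Subgroup (A × A) where
  carrier := {p | ∃ y, (p.1, y) ∈ Δ ∧ (y, p.2) ∈ Γ}
  one_mem' := ⟨1, Δ.one_mem, Γ.one_mem⟩
  mul_mem' := by
    rintro p q ⟨y, h1, h2⟩ ⟨z, h3, h4⟩
    exact ⟨y * z, Δ.mul_mem h1 h3, Γ.mul_mem h2 h4⟩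
  inv_mem' := by
    rintro p ⟨y, h1, h2⟩
    exact ⟨y⁻¹, Δ.inv_mem h1, Γ.inv_mem h2⟩

/-- Pointwise sum of relations (the group being written multiplicatively). -/
def relAdd (Γ Δ : Subgroup (A × A)) : Subgroup (A × A) where
  carrier := {p | ∃ u v, (p.1, u) ∈ Γ ∧ (p.1, v) ∈ Δ ∧ u * v = p.2}
  one_mem' := ⟨1, 1, Γ.one_mem, Δ.one_mem, by simp⟩
  mul_mem' := by
    rintro p q ⟨u, v, h1, h2, h3⟩ ⟨u', v', h1', h2', h3'⟩
    exact ⟨u * u', v * v', Γ.mul_mem h1 h1', Δ.mul_mem h2 h2',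
      by rw [Prod.snd_mul, ← h3, ← h3', mul_mul_mul_comm]⟩
  inv_mem' := by
    rintro p ⟨u, v, h1, h2, h3⟩
    exact ⟨u⁻¹, v⁻¹, Γ.inv_mem h1, Δ.inv_mem h2, by rw [Prod.snd_inv, ← h3, mul_inv]⟩

/-- Pointwise opposite of a relation. -/
def relNeg (Γ : Subgroup (A × A)) : Subgroup (A × A) where
  carrier := {p | (p.1, p.2⁻¹) ∈ Γ}
  one_mem' := by
    have : ((1 : A), (1 : A)⁻¹) = 1 := by simp
    change ((1 : A), (1 : A)⁻¹) ∈ Γ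
    rw [this]
    exact Γ.one_mem
  mul_mem' := by
    rintro p q h1 h2
    have := Γ.mul_mem h1 h2
    simpa [mul_comm] using this
  inv_mem' := by
    rintro p h1
    have := Γ.inv_mem h1
    simpa using this

variable (A) in
/-- The graph of the zero endomorphism (the constant map `1`). -/
def relZero : Subgroup (A × A) where
  carrier := {p | p.2 = 1}
  one_mem' := rfl
  mul_mem' := by
    rintro p q (h1 : p.2 = 1) (h2 : q.2 = 1)
    simp [h1, h2]
  inv_mem' := by
    rintro p (h1 : p.2 = 1)
    simp [h1]

variable (A) in
/-- The graph of the identity. -/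
def relOne : Subgroup (A × A) where
  carrier := {p | p.1 = p.2}
  one_mem' := rfl
  mul_mem' := by
    rintro p q (h1 : p.1 = p.2) (h2 : q.1 = q.2)
    simp [h1, h2]
  inv_mem' := by
    rintro p (h1 : p.1 = p.2)
    simp [h1]

/-- The converse relation. -/
def relInv (Γ : Subgroup (A × A)) : Subgroup (A × A) where
  carrier := {p | (p.2, p.1) ∈ Γ}
  one_mem' := Γ.one_mem
  mul_mem' := by
    rintro p q h1 h2
    exact Γ.mul_mem h1 h2
  inv_mem' := by
    rintro p h1
    exact Γ.inv_mem h1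

theorem mem_relComp {Γ Δ : Subgroup (A × A)} {p : A × A} :
    p ∈ relComp Γ Δ ↔ ∃ y, (p.1, y) ∈ Δ ∧ (y, p.2) ∈ Γ := Iff.rfl

theorem mem_relAdd {Γ Δ : Subgroup (A × A)} {p : A × A} :
    p ∈ relAdd Γ Δ ↔ ∃ u v, (p.1, u) ∈ Γ ∧ (p.1, v) ∈ Δ ∧ u * v = p.2 := Iff.rfl

theorem mem_relNeg {Γ : Subgroup (A × A)} {p : A × A} :
    p ∈ relNeg Γ ↔ (p.1, p.2⁻¹) ∈ Γ := Iff.rfl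

theorem mem_relZero {p : A × A} : p ∈ relZero A ↔ p.2 = 1 := Iff.rfl

theorem mem_relOne {p : A × A} : p ∈ relOne A ↔ p.1 = p.2 := Iff.rfl

theorem mem_relInv {Γ : Subgroup (A × A)} {p : A × A} :
    p ∈ relInv Γ ↔ (p.2, p.1) ∈ Γ := Iff.rfl

theorem mem_dom {Γ : Subgroup (A × A)} {x : A} :
    x ∈ Γ.map (MonoidHom.fst A A) ↔ ∃ y, (x, y) ∈ Γ := by
  constructor
  · rintro ⟨⟨a, b⟩, h, rfl⟩
    exact ⟨b, h⟩
  · rintro ⟨y, h⟩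
    exact ⟨(x, y), h, rfl⟩

/-- A subgroup relation has finite index in a larger one, if the domain of the former has finite
index and the indeterminacy of the latter is finite. -/
theorem relIndex_ne_zero_of_le {Γ Δ : Subgroup (A × A)} (h : Γ ≤ Δ)
    (hΓ : (Γ.map (MonoidHom.fst A A)).FiniteIndex)
    (hΔ : {y : A | ((1 : A), y) ∈ Δ}.Finite) : Γ.relIndex Δ ≠ 0 := by
  let C : Subgroup (A × A) := Δ ⊓ (MonoidHom.fst A A).ker
  have hC : Finite C := by
    have : ((fun y : A => ((1 : A), y)) '' {y : A | ((1 : A), y) ∈ Δ}).Finite := hΔ.image _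
    refine Set.Finite.to_subtype (this.subset ?_)
    rintro ⟨a, b⟩ ⟨h1, h2⟩
    have h2' : a = 1 := h2
    subst h2'
    exact ⟨b, h1, rfl⟩
  let D : Subgroup (A × A) := Δ ⊓ (Γ.map (MonoidHom.fst A A)).comap (MonoidHom.fst A A)
  have h1 : D.relIndex Δ ≠ 0 := by
    have : ((Γ.map (MonoidHom.fst A A)).comap (MonoidHom.fst A A)).relIndex Δ ≠ 0 := by
      have h3 : (Γ.map (MonoidHom.fst A A)).relIndex ⊤ ≠ 0 := by
        rw [Subgroup.relIndex_top_right]; exact hΓ.index_ne_zero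
      have h4 := Subgroup.relIndex_comap_ne_zero (MonoidHom.fst A A) h3
      exact mt (Subgroup.relIndex_eq_zero_of_le_right le_top) h4
    rwa [Subgroup.inf_relIndex_left]
  have h2 : Γ.relIndex (C ⊔ Γ) ≠ 0 := by
    rw [Subgroup.relIndex_sup_right]
    exact (inferInstance : (Γ.subgroupOf C).FiniteIndex).index_ne_zero
  have h3 : D ≤ C ⊔ Γ := by
    rintro ⟨x, y⟩ ⟨hxy, hx⟩
    obtain ⟨y', hy'⟩ := mem_dom.1 hx
    have : (x, y) = ((1 : A), y * y'⁻¹) * (x, y') := by simp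
    rw [this]
    refine Subgroup.mul_mem_sup ⟨?_, rfl⟩ hy'
    have h5 := Δ.mul_mem hxy (Δ.inv_mem (h hy'))
    simpa using h5
  exact Subgroup.relIndex_ne_zero_trans (mt (Subgroup.relIndex_eq_zero_of_le_right h3) h2) h1

theorem relIndex_map_ne_zero {B C : Type*} [CommGroup B] [CommGroup C] (f : B →* C)
    {H K : Subgroup B} (hHK : H ≤ K) (h : H.relIndex K ≠ 0) :
    (H.map f).relIndex (K.map f) ≠ 0 := by
  rw [Subgroup.relIndex_map_map]
  have h1 : K ⊔ f.ker = K ⊔ (H ⊔ f.ker) := by rw [← sup_assoc, sup_eq_left.2 hHK]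
  rw [h1, Subgroup.relIndex_sup_right]
  exact mt (Subgroup.relIndex_eq_zero_of_le_left le_sup_left) h

theorem commensurable_of_le {Θ Γ Δ : Subgroup (A × A)} (hΘ : (Θ.map (MonoidHom.fst A A)).FiniteIndex)
    (hΓ : IsQuasiEnd Γ) (hΔ : IsQuasiEnd Δ) (h1 : Θ ≤ Γ) (h2 : Θ ≤ Δ) :
    Subgroup.Commensurable Γ Δ :=
  ⟨fun h => relIndex_ne_zero_of_le h2 hΘ hΔ.indet (Subgroup.relIndex_eq_zero_of_le_left h1 h),
    fun h => relIndex_ne_zero_of_le h1 hΘ hΓ.indet (Subgroup.relIndex_eq_zero_of_le_left h2 h)⟩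

theorem IsQuasiEnd.inf {Γ Δ : Subgroup (A × A)} (hΓ : IsQuasiEnd Γ)
    (h : Subgroup.Commensurable Γ Δ) : IsQuasiEnd (Γ ⊓ Δ) := by
  refine ⟨⟨?_⟩, hΓ.indet.subset fun y hy => hy.1⟩
  have h1 : (Γ ⊓ Δ).relIndex Γ ≠ 0 := by rw [Subgroup.inf_relIndex_left]; exact h.2
  have h2 : ((Γ ⊓ Δ).map (MonoidHom.fst A A)).relIndex (Γ.map (MonoidHom.fst A A)) ≠ 0 := by
    exact relIndex_map_ne_zero _ inf_le_left h1
  have h3 : (Γ.map (MonoidHom.fst A A)).relIndex ⊤ ≠ 0 := by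
    rw [Subgroup.relIndex_top_right]; exact hΓ.dom.index_ne_zero
  rw [← Subgroup.relIndex_top_right]
  exact Subgroup.relIndex_ne_zero_trans h2 h3

theorem IsQuasiEnd.relComp {Γ Δ : Subgroup (A × A)} (hΓ : IsQuasiEnd Γ) (hΔ : IsQuasiEnd Δ) :
    IsQuasiEnd (relComp Γ Δ) := by
  constructor
  · constructor
    have h1 : (Γ.map (MonoidHom.fst A A)).relIndex ⊤ ≠ 0 := by
      rw [Subgroup.relIndex_top_right]; exact hΓ.dom.index_ne_zero
    have h2 := Subgroup.relIndex_comap_ne_zero (MonoidHom.snd A A) h1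
    have h3 : (Δ ⊓ (Γ.map (MonoidHom.fst A A)).comap (MonoidHom.snd A A)).relIndex Δ ≠ 0 := by
      rw [Subgroup.inf_relIndex_left]
      exact mt (Subgroup.relIndex_eq_zero_of_le_right le_top) h2
    have h4 : ((Δ ⊓ (Γ.map (MonoidHom.fst A A)).comap (MonoidHom.snd A A)).map
        (MonoidHom.fst A A)).relIndex (Δ.map (MonoidHom.fst A A)) ≠ 0 :=
      relIndex_map_ne_zero _ inf_le_left h3
    have h5 : (Δ.map (MonoidHom.fst A A)).relIndex ⊤ ≠ 0 := by
      rw [Subgroup.relIndex_top_right]; exact hΔ.dom.index_ne_zero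
    rw [← Subgroup.relIndex_top_right]
    refine mt (Subgroup.relIndex_eq_zero_of_le_left ?_) (Subgroup.relIndex_ne_zero_trans h4 h5)
    rintro _ ⟨⟨x, y⟩, ⟨hxy, hy⟩, rfl⟩
    obtain ⟨z, hz⟩ := mem_dom.1 hy
    exact mem_dom.2 ⟨z, y, hxy, hz⟩
  · have h : ∀ y ∈ {y : A | ((1 : A), y) ∈ Δ}, {z : A | (y, z) ∈ Γ}.Finite := by
      intro y _
      by_cases hy : ∃ z0, (y, z0) ∈ Γ
      · obtain ⟨z0, hz0⟩ := hy
        refine (hΓ.indet.image (fun w => w * z0)).subset ?_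
        intro z hz
        refine ⟨z * z0⁻¹, ?_, by simp⟩
        have := Γ.mul_mem hz (Γ.inv_mem hz0)
        simpa using this
      · push Not at hy
        convert Set.finite_empty
        ext z
        simp [hy z]
    refine (hΔ.indet.biUnion h).subset ?_
    rintro z ⟨y, h1, h2⟩
    exact Set.mem_biUnion h1 h2

theorem IsQuasiEnd.relAdd {Γ Δ : Subgroup (A × A)} (hΓ : IsQuasiEnd Γ) (hΔ : IsQuasiEnd Δ) :
    IsQuasiEnd (relAdd Γ Δ) := by
  constructor
  · have := hΓ.dom
    have := hΔ.dom
    refine Subgroup.finiteIndex_of_le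
      (H := Γ.map (MonoidHom.fst A A) ⊓ Δ.map (MonoidHom.fst A A)) ?_
    rintro x ⟨h1, h2⟩
    obtain ⟨u, hu⟩ := mem_dom.1 h1
    obtain ⟨v, hv⟩ := mem_dom.1 h2
    exact mem_dom.2 ⟨u * v, u, v, hu, hv, rfl⟩
  · refine ((hΓ.indet.prod hΔ.indet).image fun p => p.1 * p.2).subset ?_
    rintro y ⟨u, v, h1, h2, h3⟩
    exact ⟨(u, v), ⟨h1, h2⟩, h3⟩

theorem IsQuasiEnd.relNeg {Γ : Subgroup (A × A)} (hΓ : IsQuasiEnd Γ) : IsQuasiEnd (relNeg Γ) := by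
  constructor
  · have := hΓ.dom
    refine Subgroup.finiteIndex_of_le (H := Γ.map (MonoidHom.fst A A)) ?_
    intro x h1
    obtain ⟨u, hu⟩ := mem_dom.1 h1
    exact mem_dom.2 ⟨u⁻¹, by simpa [mem_relNeg] using hu⟩
  · refine (hΓ.indet.image fun y => y⁻¹).subset ?_
    intro y h1
    exact ⟨y⁻¹, h1, by simp⟩

variable (A) in
theorem isQuasiEnd_relZero : IsQuasiEnd (relZero A) := by
  constructor
  · have : (relZero A).map (MonoidHom.fst A A) = ⊤ := by
      ext x
      simp only [Subgroup.mem_top, iff_true]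
      exact mem_dom.2 ⟨1, rfl⟩
    rw [this]
    infer_instance
  · exact (Set.finite_singleton (1 : A)).subset fun y hy => hy

variable (A) in
theorem isQuasiEnd_relOne : IsQuasiEnd (relOne A) := by
  constructor
  · have : (relOne A).map (MonoidHom.fst A A) = ⊤ := by
      ext x
      simp only [Subgroup.mem_top, iff_true]
      exact mem_dom.2 ⟨x, rfl⟩
    rw [this]
    infer_instance
  · exact (Set.finite_singleton (1 : A)).subset fun y hy => Eq.symm hy

variable (A) in
/-- Commensurability of quasi-endomorphisms. -/
instance quasiEndSetoid : Setoid (QuasiEnd A) where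
  r Γ Δ := Subgroup.Commensurable Γ.1 Δ.1
  iseqv := ⟨fun _ => Subgroup.Commensurable.refl _, fun h => h.symm, fun h h' => h.trans h'⟩

variable (A) in
/-- The ring of quasi-endomorphisms of `A` modulo commensurability. -/
def QuasiEndRing : Type _ := Quotient (quasiEndSetoid A)

namespace QuasiEndRing

/-- The class of a quasi-endomorphism. -/
def mk (Γ : Subgroup (A × A)) (h : IsQuasiEnd Γ) : QuasiEndRing A :=
  Quotient.mk (quasiEndSetoid A) ⟨Γ, h⟩

theorem mk_eq_mk {Γ Δ : Subgroup (A × A)} {hΓ : IsQuasiEnd Γ} {hΔ : IsQuasiEnd Δ} :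
    mk Γ hΓ = mk Δ hΔ ↔ Subgroup.Commensurable Γ Δ :=
  ⟨fun h => Quotient.exact h, fun h => Quotient.sound h⟩

theorem ind {p : QuasiEndRing A → Prop} (h : ∀ Γ hΓ, p (mk Γ hΓ)) (r : QuasiEndRing A) : p r :=
  Quotient.inductionOn r fun Γ => h Γ.1 Γ.2

/-- A way to prove equality of classes: find a common restriction. -/
theorem mk_eq_of_le {Θ Γ Δ : Subgroup (A × A)} {hΓ : IsQuasiEnd Γ} {hΔ : IsQuasiEnd Δ}
    (hΘ : (Θ.map (MonoidHom.fst A A)).FiniteIndex) (h1 : Θ ≤ Γ) (h2 : Θ ≤ Δ) :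
    mk Γ hΓ = mk Δ hΔ :=
  mk_eq_mk.2 (commensurable_of_le hΘ hΓ hΔ h1 h2)

theorem mk_congr {Γ Δ : Subgroup (A × A)} {hΓ : IsQuasiEnd Γ} {hΔ : IsQuasiEnd Δ}
    (h : ∀ p, p ∈ Γ ↔ p ∈ Δ) : mk Γ hΓ = mk Δ hΔ := by
  obtain rfl : Γ = Δ := Subgroup.ext h
  rfl

/-- The sum of classes is the class of the pointwise sum. -/
instance : Add (QuasiEndRing A) :=
  ⟨Quotient.map₂ (fun Γ Δ => ⟨relAdd Γ.1 Δ.1, Γ.2.relAdd Δ.2⟩) (by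
    rintro Γ Γ' h Δ Δ' h'
    refine commensurable_of_le ((Γ.2.inf h).relAdd (Δ.2.inf h')).dom (Γ.2.relAdd Δ.2)
      (Γ'.2.relAdd Δ'.2) ?_ ?_
    · rintro p ⟨u, v, h1, h2, h3⟩
      exact ⟨u, v, h1.1, h2.1, h3⟩
    · rintro p ⟨u, v, h1, h2, h3⟩
      exact ⟨u, v, h1.2, h2.2, h3⟩)⟩

/-- The product of classes is the class of the composition. -/
instance : Mul (QuasiEndRing A) :=
  ⟨Quotient.map₂ (fun Γ Δ => ⟨relComp Γ.1 Δ.1, Γ.2.relComp Δ.2⟩) (by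
    rintro Γ Γ' h Δ Δ' h'
    refine commensurable_of_le ((Γ.2.inf h).relComp (Δ.2.inf h')).dom (Γ.2.relComp Δ.2)
      (Γ'.2.relComp Δ'.2) ?_ ?_
    · rintro p ⟨u, h1, h2⟩
      exact ⟨u, h1.1, h2.1⟩
    · rintro p ⟨u, h1, h2⟩
      exact ⟨u, h1.2, h2.2⟩)⟩

instance : Neg (QuasiEndRing A) :=
  ⟨Quotient.map (fun Γ => ⟨relNeg Γ.1, Γ.2.relNeg⟩) (by
    rintro Γ Γ' h
    exact commensurable_of_le (Γ.2.inf h).relNeg.dom Γ.2.relNeg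
      Γ'.2.relNeg (fun p hp => hp.1) (fun p hp => hp.2))⟩

instance : Zero (QuasiEndRing A) := ⟨mk (relZero A) (isQuasiEnd_relZero A)⟩

instance : One (QuasiEndRing A) := ⟨mk (relOne A) (isQuasiEnd_relOne A)⟩

theorem mk_add {Γ Δ : Subgroup (A × A)} (hΓ : IsQuasiEnd Γ) (hΔ : IsQuasiEnd Δ) :
    mk Γ hΓ + mk Δ hΔ = mk (relAdd Γ Δ) (hΓ.relAdd hΔ) := rfl

theorem mk_mul {Γ Δ : Subgroup (A × A)} (hΓ : IsQuasiEnd Γ) (hΔ : IsQuasiEnd Δ) :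
    mk Γ hΓ * mk Δ hΔ = mk (relComp Γ Δ) (hΓ.relComp hΔ) := rfl

theorem mk_neg {Γ : Subgroup (A × A)} (hΓ : IsQuasiEnd Γ) :
    -mk Γ hΓ = mk (relNeg Γ) hΓ.relNeg := rfl

theorem zero_def : (0 : QuasiEndRing A) = mk (relZero A) (isQuasiEnd_relZero A) := rfl

theorem one_def : (1 : QuasiEndRing A) = mk (relOne A) (isQuasiEnd_relOne A) := rfl

private theorem add_comm' (r s : QuasiEndRing A) : r + s = s + r := by
  induction r using ind with | h Γ hΓ =>
  induction s using ind with | h Δ hΔ =>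
  rw [mk_add, mk_add]
  refine mk_congr fun p => ⟨?_, ?_⟩ <;>
  · rintro ⟨u, v, h1, h2, h3⟩
    exact ⟨v, u, h2, h1, by rw [mul_comm]; exact h3⟩

private theorem add_assoc' (r s t : QuasiEndRing A) : r + s + t = r + (s + t) := by
  induction r using ind with | h Γ hΓ =>
  induction s using ind with | h Δ hΔ =>
  induction t using ind with | h Θ hΘ =>
  simp only [mk_add]
  refine mk_congr fun p => ⟨?_, ?_⟩
  · rintro ⟨u, v, ⟨u', v', h1, h2, h3⟩, h4, h5⟩
    exact ⟨u', v' * v, h1, ⟨v', v, h2, h4, rfl⟩, by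
      have h3' : u' * v' = u := h3
      rw [← h5, ← h3', mul_assoc]⟩
  · rintro ⟨u, v, h4, ⟨u', v', h1, h2, h3⟩, h5⟩
    exact ⟨u * u', v', ⟨u, u', h4, h1, rfl⟩, h2, by
      have h3' : u' * v' = v := h3
      rw [← h5, ← h3', mul_assoc]⟩

private theorem zero_add' (r : QuasiEndRing A) : 0 + r = r := by
  induction r using ind with | h Γ hΓ =>
  rw [zero_def, mk_add]
  refine mk_congr fun p => ⟨?_, ?_⟩
  · rintro ⟨u, v, h1, h2, h3⟩
    have h1' : u = 1 := h1
    rw [h1', one_mul] at h3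
    rw [h3] at h2
    exact h2
  · intro h
    exact ⟨1, p.2, rfl, h, one_mul _⟩

private theorem neg_add' (r : QuasiEndRing A) : -r + r = 0 := by
  induction r using ind with | h Γ hΓ =>
  rw [zero_def, mk_neg, mk_add]
  have hΘ : IsQuasiEnd (relComp (relZero A) Γ) := (isQuasiEnd_relZero A).relComp hΓ
  refine mk_eq_of_le hΘ.dom ?_ ?_
  · rintro ⟨x, z⟩ ⟨y, h1, h2⟩
    exact ⟨y⁻¹, y, by simpa [mem_relNeg] using h1, h1, by simpa using (Eq.symm h2)⟩
  · rintro ⟨x, z⟩ ⟨y, h1, h2⟩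
    exact h2

private theorem mul_assoc' (r s t : QuasiEndRing A) : r * s * t = r * (s * t) := by
  induction r using ind with | h Γ hΓ =>
  induction s using ind with | h Δ hΔ =>
  induction t using ind with | h Θ hΘ =>
  simp only [mk_mul]
  refine mk_congr fun p => ⟨?_, ?_⟩
  · rintro ⟨u, h1, v, h2, h3⟩
    exact ⟨v, ⟨u, h1, h2⟩, h3⟩
  · rintro ⟨u, ⟨v, h2, h3⟩, h1⟩
    exact ⟨v, h2, u, h3, h1⟩

private theorem one_mul' (r : QuasiEndRing A) : 1 * r = r := by
  induction r using ind with | h Γ hΓ =>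
  rw [one_def, mk_mul]
  refine mk_congr fun p => ⟨?_, ?_⟩
  · rintro ⟨u, h1, h2⟩
    have h2' : u = p.2 := h2
    rw [h2'] at h1
    exact h1
  · intro h
    exact ⟨p.2, h, rfl⟩

private theorem mul_one' (r : QuasiEndRing A) : r * 1 = r := by
  induction r using ind with | h Γ hΓ =>
  rw [one_def, mk_mul]
  refine mk_congr fun p => ⟨?_, ?_⟩
  · rintro ⟨u, h1, h2⟩
    have h1' : p.1 = u := h1
    rw [← h1'] at h2
    exact h2
  · intro h
    exact ⟨p.1, rfl, h⟩

private theorem zero_mul' (r : QuasiEndRing A) : 0 * r = 0 := by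
  induction r using ind with | h Γ hΓ =>
  rw [zero_def, mk_mul]
  refine mk_eq_of_le ((isQuasiEnd_relZero A).relComp hΓ).dom le_rfl ?_
  rintro ⟨x, z⟩ ⟨y, h1, h2⟩
  exact h2

private theorem mul_zero' (r : QuasiEndRing A) : r * 0 = 0 := by
  induction r using ind with | h Γ hΓ =>
  rw [zero_def, mk_mul]
  refine mk_eq_of_le (isQuasiEnd_relZero A).dom ?_ le_rfl
  rintro ⟨x, z⟩ h
  have h' : z = 1 := h
  subst h'
  exact ⟨1, rfl, Γ.one_mem⟩

private theorem add_mul' (r s t : QuasiEndRing A) : (r + s) * t = r * t + s * t := by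
  induction r using ind with | h Γ hΓ =>
  induction s using ind with | h Δ hΔ =>
  induction t using ind with | h Θ hΘ =>
  simp only [mk_mul, mk_add]
  refine mk_eq_of_le ((hΓ.relAdd hΔ).relComp hΘ).dom le_rfl ?_
  rintro ⟨x, z⟩ ⟨y, h1, u, v, h2, h3, h4⟩
  exact ⟨u, v, ⟨y, h1, h2⟩, ⟨y, h1, h3⟩, h4⟩

private theorem mul_add' (r s t : QuasiEndRing A) : t * (r + s) = t * r + t * s := by
  induction r using ind with | h Γ hΓ =>
  induction s using ind with | h Δ hΔ =>
  induction t using ind with | h Θ hΘ =>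
  simp only [mk_mul, mk_add]
  refine mk_eq_of_le ((hΘ.relComp hΓ).relAdd (hΘ.relComp hΔ)).dom ?_ le_rfl
  rintro ⟨x, z⟩ ⟨u, v, ⟨y, h1, h2⟩, ⟨y', h3, h4⟩, h5⟩
  have h6 := Θ.mul_mem h2 h4
  rw [Prod.mk_mul_mk, h5] at h6
  exact ⟨y * y', ⟨y, y', h1, h3, rfl⟩, h6⟩

instance : Ring (QuasiEndRing A) where
  add_assoc := add_assoc'
  zero_add := zero_add'
  add_zero r := by rw [add_comm', zero_add']
  add_comm := add_comm'
  left_distrib t r s := mul_add' r s t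
  right_distrib := add_mul'
  zero_mul := zero_mul'
  mul_zero := mul_zero'
  mul_assoc := mul_assoc'
  one_mul := one_mul'
  mul_one := mul_one'
  neg_add_cancel := neg_add'
  nsmul := nsmulRec
  zsmul := zsmulRec

end QuasiEndRing

end QuasiEndomorphisms

set_option linter.unusedSectionVars false

/-! ## Small compact `G`-spaces and imaginary sorts -/

section Sorts

variable (G X : Type*) [Group G] [MulAction G X]

/-- Smallness: `G` has only countably many orbits on `X ^ n`, for every `n`. -/
def IsSmall : Prop :=
  ∀ n : ℕ, Countable (MulAction.orbitRel.Quotient G (Fin n → X))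

/-- A `G`-invariant equivalence relation on some finite power of `X`. -/
structure InvRel where
  /-- the exponent -/
  n : ℕ
  /-- the equivalence relation on `X ^ n` -/
  rel : Setoid (Fin n → X)
  invariant : ∀ (g : G) (a b : Fin n → X), rel a b → rel (g • a) (g • b)

variable {G X}

/-- The quotient `X ^ n / E`. -/
def InvRel.Elem (s : InvRel G X) : Type _ := Quotient s.rel

/-- `G` acts on `X ^ n / E` through representatives. -/
instance (s : InvRel G X) : MulAction G s.Elem where
  smul g := Quotient.map (fun a => g • a) (fun a b h => s.invariant g a b h)
  one_smul q := by
    induction q using Quotient.inductionOn with | h a =>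
    exact congrArg (Quotient.mk s.rel) (one_smul G a)
  mul_smul g h q := by
    induction q using Quotient.inductionOn with | h a =>
    exact congrArg (Quotient.mk s.rel) (mul_smul g h a)

/-- The quotient topology on `X ^ n / E`. -/
instance [TopologicalSpace X] (s : InvRel G X) : TopologicalSpace s.Elem :=
  inferInstanceAs (TopologicalSpace (Quotient s.rel))

instance [TopologicalSpace X] [CompactSpace X] (s : InvRel G X) : CompactSpace s.Elem :=
  inferInstanceAs (CompactSpace (Quotient s.rel))

/-- `X ^ n / E` is a sort of the imaginary extension: the stabilizer of every class is closed. -/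
def InvRel.IsSort [TopologicalSpace G] (s : InvRel G X) : Prop :=
  ∀ q : s.Elem, IsClosed (MulAction.stabilizer G q : Set G)

/-- `X ^ n / E` is a topological sort: `E` is closed in `X ^ n × X ^ n`. -/
def InvRel.IsTopSort [TopologicalSpace X] (s : InvRel G X) : Prop :=
  IsClosed {p : (Fin s.n → X) × (Fin s.n → X) | s.rel p.1 p.2}

variable (G X) in
/-- The imaginary extension `X ^ eq`: the disjoint union of all sorts. -/
def Imaginary [TopologicalSpace G] : Type _ :=
  Σ s : {s : InvRel G X // s.IsSort}, s.1.Elem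

instance [TopologicalSpace G] : MulAction G (Imaginary G X) where
  smul g x := ⟨x.1, g • x.2⟩
  one_smul x := by
    obtain ⟨s, q⟩ := x
    exact congrArg (Sigma.mk s) (one_smul G q)
  mul_smul g h x := by
    obtain ⟨s, q⟩ := x
    exact congrArg (Sigma.mk s) (mul_smul g h q)

end Sorts

/-! ## Closed sets over parameters -/

section StarClosed

variable {G : Type*} [Group G] (X : Type*) [MulAction G X]
variable {Y Z : Type*} [TopologicalSpace Y] [MulAction G Y] [TopologicalSpace Z] [MulAction G Z]

/-- `S` is closed and invariant under the subgroup `K`.  If `K` is the pointwise stabilizer of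
a set `P` of parameters, this says that `S` is `P`-closed. -/
def IsClosedOver (K : Subgroup G) (S : Set Y) : Prop :=
  IsClosed S ∧ ∀ g ∈ K, g • S = S

variable (G) in
/-- `S` is `P`-closed for some finite set `P` of (imaginary) parameters. -/
def IsStarClosed [TopologicalSpace G] (S : Set Y) : Prop :=
  ∃ P : Set (Imaginary G X), P.Finite ∧ IsClosedOver (fixingSubgroup G P) S

theorem isClosedOver_iff {K : Subgroup G} {S : Set Y} :
    IsClosedOver K S ↔ IsClosed S ∧ ∀ g ∈ K, ∀ y ∈ S, g • y ∈ S := by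
  refine and_congr_right fun _ => ⟨fun h g hg y hy => ?_, fun h g hg => ?_⟩
  · rw [← h g hg]
    exact Set.smul_mem_smul_set hy
  · apply Set.Subset.antisymm
    · rintro _ ⟨y, hy, rfl⟩
      exact h g hg y hy
    · intro y hy
      exact ⟨g⁻¹ • y, h g⁻¹ (K.inv_mem hg) y hy, by simp⟩

theorem IsClosedOver.inter {K : Subgroup G} {S S' : Set Y} (h : IsClosedOver K S)
    (h' : IsClosedOver K S') : IsClosedOver K (S ∩ S') := by
  rw [isClosedOver_iff] at *
  exact ⟨h.1.inter h'.1, fun g hg y hy => ⟨h.2 g hg y hy.1, h'.2 g hg y hy.2⟩⟩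

theorem IsClosedOver.preimage {K : Subgroup G} {S : Set Z} (h : IsClosedOver K S) {f : Y → Z}
    (hf : Continuous f) (hfg : ∀ (g : G) (y : Y), f (g • y) = g • f y) :
    IsClosedOver K (f ⁻¹' S) := by
  rw [isClosedOver_iff] at *
  refine ⟨h.1.preimage hf, fun g hg y hy => ?_⟩
  rw [Set.mem_preimage, hfg]
  exact h.2 g hg _ hy

theorem IsClosedOver.proj [CompactSpace Z] {K : Subgroup G} {S : Set (Y × Z)}
    (h : IsClosedOver K S) : IsClosedOver K (Prod.fst '' S) := by
  rw [isClosedOver_iff] at *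
  refine ⟨isClosedMap_fst_of_compactSpace _ h.1, ?_⟩
  rintro g hg _ ⟨p, hp, rfl⟩
  exact ⟨g • p, h.2 g hg p hp, rfl⟩

theorem IsClosedOver.mono {K K' : Subgroup G} (hK : K ≤ K') {S : Set Y}
    (h : IsClosedOver K' S) : IsClosedOver K S := ⟨h.1, fun g hg => h.2 g (hK hg)⟩

variable [TopologicalSpace G] {X}

theorem IsStarClosed.inter {S S' : Set Y} (h : IsStarClosed G X S)
    (h' : IsStarClosed G X S') : IsStarClosed G X (S ∩ S') := by
  obtain ⟨P, hP, h⟩ := h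
  obtain ⟨P', hP', h'⟩ := h'
  exact ⟨P ∪ P', hP.union hP',
    (h.mono (fixingSubgroup_antitone G _ Set.subset_union_left)).inter
    (h'.mono (fixingSubgroup_antitone G _ Set.subset_union_right))⟩

theorem IsStarClosed.preimage {S : Set Z} (h : IsStarClosed G X S) {f : Y → Z}
    (hf : Continuous f) (hfg : ∀ (g : G) (y : Y), f (g • y) = g • f y) :
    IsStarClosed G X (f ⁻¹' S) := by
  obtain ⟨P, hP, h⟩ := h
  exact ⟨P, hP, h.preimage hf hfg⟩

theorem IsStarClosed.proj [CompactSpace Z] {S : Set (Y × Z)}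
    (h : IsStarClosed G X S) : IsStarClosed G X (Prod.fst '' S) := by
  obtain ⟨P, hP, h⟩ := h
  exact ⟨P, hP, h.proj⟩

end StarClosed

/-! ## Groups living on a sort, minimal subgroups, virtual isogenies -/

section Groups

open scoped IsMulCommutative

variable {G X : Type*} [Group G] [TopologicalSpace G] [TopologicalSpace X] [MulAction G X]
variable {s : InvRel G X} {H : Set s.Elem} [Group H]

/-- The graph of the multiplication of a group whose underlying set is a subset of a sort. -/
def mulGraph (H : Set s.Elem) [Group H] : Set (s.Elem × s.Elem × s.Elem) :=
  Set.range fun p : H × H => ((p.1 : s.Elem), (p.2 : s.Elem), ((p.1 * p.2 : H) : s.Elem))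

/-- The group `H` is closed and invariant under `K`: both its underlying set and its operation
are. -/
def IsClosedGroupOver (K : Subgroup G) (H : Set s.Elem) [Group H] : Prop :=
  IsClosedOver K H ∧ IsClosedOver K (mulGraph H)

/-- The group `H` is `*`-closed: both its underlying set and its operation are. -/
def IsStarClosedGroup (H : Set s.Elem) [Group H] : Prop :=
  IsStarClosed G X H ∧ IsStarClosed G X (mulGraph H)

/-- The underlying set, inside the sort, of a subgroup of `H`. -/
def subgroupSet (A : Subgroup H) : Set s.Elem := Set.range fun x : A => ((x : H) : s.Elem)

/-- The underlying set, inside the square of the sort, of a subgroup of `A × B`. -/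
def relSet {A B : Subgroup H} (Γ : Subgroup (A × B)) : Set (s.Elem × s.Elem) :=
  (fun p : A × B => (((p.1 : H) : s.Elem), ((p.2 : H) : s.Elem))) '' Γ

/-- A minimal subgroup: infinite, `*`-closed, and all its `*`-closed subgroups of infinite index
are finite. -/
structure IsMinimalSubgroup (A : Subgroup H) : Prop where
  infinite : Infinite A
  isStarClosed : IsStarClosed G X (subgroupSet A)
  finite_of_infinite_index : ∀ B : Subgroup H, B ≤ A → IsStarClosed G X (subgroupSet B) →
    ¬ B.IsFiniteRelIndex A → Finite B

/-- The graph in `A × B` of an isomorphism between a section `D / K` of `A` and a section `I / C`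
of `B`. -/
def sectionGraph {A B : Type*} [CommGroup A] [CommGroup B] {D K : Subgroup A} {I C : Subgroup B}
    (f : (D ⧸ K.subgroupOf D) ≃* (I ⧸ C.subgroupOf I)) : Subgroup (A × B) where
  carrier := {p | ∃ (hx : p.1 ∈ D) (hy : p.2 ∈ I),
    f (QuotientGroup.mk ⟨p.1, hx⟩) = QuotientGroup.mk ⟨p.2, hy⟩}
  one_mem' := ⟨D.one_mem, I.one_mem, map_one f⟩
  mul_mem' := by
    rintro p q ⟨hx, hy, h⟩ ⟨hx', hy', h'⟩
    refine ⟨D.mul_mem hx hx', I.mul_mem hy hy', ?_⟩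
    have := congrArg₂ (· * ·) h h'
    simp only [← map_mul] at this
    exact this
  inv_mem' := by
    rintro p ⟨hx, hy, h⟩
    refine ⟨D.inv_mem hx, I.inv_mem hy, ?_⟩
    have := congrArg (·⁻¹) h
    simp only [← map_inv] at this
    exact this

/-- A virtual isogeny between abelian subgroups `A` and `B` of `H`: a `*`-closed isomorphism
`D / K ≃ I / C`, where `D` is open in `A`, `I` is open in `B`, and `K`, `C` are finite. -/
structure VirtualIsogeny (A B : Subgroup H) [IsMulCommutative A] [IsMulCommutative B] where
  /-- the domain -/
  D : Subgroup A
  /-- the kernel -/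
  K : Subgroup A
  /-- the image -/
  I : Subgroup B
  /-- the indeterminacy -/
  C : Subgroup B
  isOpen_D : IsOpen (D : Set A)
  isOpen_I : IsOpen (I : Set B)
  K_le_D : K ≤ D
  C_le_I : C ≤ I
  finite_K : Finite K
  finite_C : Finite C
  /-- the isomorphism -/
  iso : (D ⧸ K.subgroupOf D) ≃* (I ⧸ C.subgroupOf I)
  isStarClosed : IsStarClosed G X (relSet (sectionGraph iso))

/-- The graph of a virtual isogeny, treated as a subgroup of `A × B`. -/
def VirtualIsogeny.graph {A B : Subgroup H} [IsMulCommutative A] [IsMulCommutative B]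
    (f : VirtualIsogeny A B) : Subgroup (A × B) := sectionGraph f.iso

/-- Virtual isogenies are equivalent if their graphs are commensurable. -/
def VirtualIsogeny.Equivalent {A B : Subgroup H} [IsMulCommutative A] [IsMulCommutative B]
    (f g : VirtualIsogeny A B) : Prop := Subgroup.Commensurable f.graph g.graph

/-- A virtual autogeny of `A` is a virtual isogeny from `A` to `A`. -/
abbrev VirtualAutogeny (A : Subgroup H) [IsMulCommutative A] := VirtualIsogeny A A

/-- The conjugate `S_b := g[S]` of an `a`-closed set `S`, where `b = g a`.  It does not depend
on the choice of `g`, as `S` is invariant under the stabilizer of `a`. -/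
def conjugateSet {Y α : Type*} [MulAction G Y] [MulAction G α] (S : Set Y) (a b : α) : Set Y :=
  {y | ∃ g : G, g • a = b ∧ y ∈ g • S}

/-- `f_x ∼ f_y` for the conjugates of an `a`-closed virtual autogeny `f = f_a` of `A`: the sets
`f_x` and `f_y` are the graphs of equivalent virtual autogenies of `A`. -/
def ConjugatesEquivalent {A : Subgroup H} [IsMulCommutative A] (f : VirtualAutogeny A)
    {n : ℕ} (a x y : Fin n → X) : Prop :=
  ∃ f₁ f₂ : VirtualAutogeny A,
    relSet f₁.graph = conjugateSet (G := G) (relSet f.graph) a x ∧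
    relSet f₂.graph = conjugateSet (G := G) (relSet f.graph) a y ∧
    f₁.Equivalent f₂

end Groups

/-! ## The division ring of virtual autogenies -/

section AutogenyRing

open scoped IsMulCommutative

variable {G X : Type*} [Group G] [TopologicalSpace G] [TopologicalSpace X] [MulAction G X]
variable {s : InvRel G X} {H : Set s.Elem} [Group H]

theorem mem_mulGraph {x y z : s.Elem} : (x, y, z) ∈ mulGraph H ↔
    ∃ a b : H, (a : s.Elem) = x ∧ (b : s.Elem) = y ∧ ((a * b : H) : s.Elem) = z := by
  constructor
  · rintro ⟨⟨a, b⟩, h⟩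
    simp only [Prod.mk.injEq] at h
    exact ⟨a, b, h⟩
  · rintro ⟨a, b, rfl, rfl, rfl⟩
    exact ⟨(a, b), rfl⟩

theorem mk_mem_mulGraph {a b : H} {z : s.Elem} :
    ((a : s.Elem), (b : s.Elem), z) ∈ mulGraph H ↔ ((a * b : H) : s.Elem) = z := by
  rw [mem_mulGraph]
  constructor
  · rintro ⟨a', b', h1, h2, h3⟩
    rw [← Subtype.ext h1, ← Subtype.ext h2]
    exact h3
  · intro h
    exact ⟨a, b, rfl, rfl, h⟩

theorem idem_mem_mulGraph {e : s.Elem} : (e, e, e) ∈ mulGraph H ↔ e = ((1 : H) : s.Elem) := by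
  constructor
  · intro h
    obtain ⟨a, b, h1, h2, h3⟩ := mem_mulGraph.1 h
    have h4 : a = b := Subtype.ext (h1.trans h2.symm)
    have h5 : a * b = a := Subtype.ext (h3.trans h1.symm)
    subst h4
    rw [mul_eq_left] at h5
    rw [← h1, h5]
  · rintro rfl
    rw [mk_mem_mulGraph, one_mul]

variable {A B : Subgroup H}

theorem mem_relSet {Γ : Subgroup (A × B)} {t : s.Elem × s.Elem} : t ∈ relSet Γ ↔
    ∃ (a : A) (b : B), (a, b) ∈ Γ ∧ ((a : H) : s.Elem) = t.1 ∧ ((b : H) : s.Elem) = t.2 := by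
  constructor
  · rintro ⟨⟨a, b⟩, h, rfl⟩
    exact ⟨a, b, h, rfl, rfl⟩
  · rintro ⟨a, b, h, h1, h2⟩
    exact ⟨(a, b), h, Prod.ext h1 h2⟩

theorem mk_mem_relSet {Γ : Subgroup (A × B)} {a : A} {b : B} :
    (((a : H) : s.Elem), ((b : H) : s.Elem)) ∈ relSet Γ ↔ (a, b) ∈ Γ := by
  rw [mem_relSet]
  constructor
  · rintro ⟨a', b', h, h1, h2⟩
    rw [← Subtype.ext (Subtype.ext h1), ← Subtype.ext (Subtype.ext h2)]
    exact h
  · intro h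
    exact ⟨a, b, h, rfl, rfl⟩

theorem relSet_injective : Function.Injective (relSet : Subgroup (A × B) → _) := by
  intro Γ Δ h
  ext ⟨a, b⟩
  rw [← mk_mem_relSet, ← mk_mem_relSet, h]

theorem mem_subgroupSet {t : s.Elem} : t ∈ subgroupSet A ↔ ∃ a : A, ((a : H) : s.Elem) = t :=
  Iff.rfl

theorem coe_mem_subgroupSet {a : H} : (a : s.Elem) ∈ subgroupSet A ↔ a ∈ A := by
  constructor
  · rintro ⟨b, hb⟩
    rw [← Subtype.ext hb]
    exact b.2
  · intro h
    exact ⟨⟨a, h⟩, rfl⟩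

section Closedness

variable [CompactSpace X] [IsMulCommutative A]

theorem isStarClosed_relComp {Γ Δ : Subgroup (A × A)} (hΓ : IsStarClosed G X (relSet Γ))
    (hΔ : IsStarClosed G X (relSet Δ)) : IsStarClosed G X (relSet (relComp Γ Δ)) := by
  have h1 := hΔ.preimage (f := fun p : (s.Elem × s.Elem) × s.Elem => (p.1.1, p.2))
    (by fun_prop) (fun g p => rfl)
  have h2 := hΓ.preimage (f := fun p : (s.Elem × s.Elem) × s.Elem => (p.2, p.1.2))
    (by fun_prop) (fun g p => rfl)
  convert (h1.inter h2).proj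
  ext ⟨t, u⟩
  constructor
  · rintro ⟨⟨a, b⟩, ⟨c, h3, h4⟩, h⟩
    obtain ⟨rfl, rfl⟩ := Prod.mk.inj h
    exact ⟨((_, _), ((c : H) : s.Elem)), ⟨mk_mem_relSet.2 h3, mk_mem_relSet.2 h4⟩, rfl⟩
  · rintro ⟨⟨⟨t', u'⟩, v⟩, ⟨h3, h4⟩, h⟩
    obtain ⟨rfl, rfl⟩ := Prod.mk.inj h
    obtain ⟨a, b, h5, rfl, rfl⟩ := mem_relSet.1 h3
    obtain ⟨b', c, h6, h7, rfl⟩ := mem_relSet.1 h4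
    obtain rfl : b' = b := Subtype.ext (Subtype.ext h7)
    exact mk_mem_relSet.2 ⟨b', h5, h6⟩

theorem isStarClosed_relAdd (hH : IsStarClosedGroup H) {Γ Δ : Subgroup (A × A)}
    (hΓ : IsStarClosed G X (relSet Γ)) (hΔ : IsStarClosed G X (relSet Δ)) :
    IsStarClosed G X (relSet (relAdd Γ Δ)) := by
  have h1 := hΓ.preimage
    (f := fun p : (s.Elem × s.Elem) × (s.Elem × s.Elem) => (p.1.1, p.2.1))
    (by fun_prop) (fun g p => rfl)
  have h2 := hΔ.preimage
    (f := fun p : (s.Elem × s.Elem) × (s.Elem × s.Elem) => (p.1.1, p.2.2))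
    (by fun_prop) (fun g p => rfl)
  have h3 := hH.2.preimage
    (f := fun p : (s.Elem × s.Elem) × (s.Elem × s.Elem) => (p.2.1, p.2.2, p.1.2))
    (by fun_prop) (fun g p => rfl)
  convert ((h1.inter h2).inter h3).proj
  ext ⟨t, w⟩
  constructor
  · rintro ⟨⟨a, b⟩, ⟨u, v, h4, h5, h6⟩, h⟩
    obtain ⟨rfl, rfl⟩ := Prod.mk.inj h
    refine ⟨((_, _), (((u : H) : s.Elem), ((v : H) : s.Elem))),
      ⟨⟨mk_mem_relSet.2 h4, mk_mem_relSet.2 h5⟩, mk_mem_mulGraph.2 ?_⟩, rfl⟩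
    exact congrArg (fun z : A => ((z : H) : s.Elem)) h6
  · rintro ⟨⟨⟨t', u'⟩, v, w⟩, ⟨⟨h4, h5⟩, h6⟩, h⟩
    obtain ⟨rfl, rfl⟩ := Prod.mk.inj h
    obtain ⟨a, b, h7, rfl, rfl⟩ := mem_relSet.1 h4
    obtain ⟨a', c, h8, h9, rfl⟩ := mem_relSet.1 h5
    obtain rfl : a' = a := Subtype.ext (Subtype.ext h9)
    have h6' := mk_mem_mulGraph.1 h6
    exact mem_relSet.2 ⟨a', b * c, ⟨b, c, h7, h8, rfl⟩, rfl, h6'⟩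

theorem isStarClosed_relNeg (hH : IsStarClosedGroup H) {Γ : Subgroup (A × A)}
    (hΓ : IsStarClosed G X (relSet Γ)) : IsStarClosed G X (relSet (relNeg Γ)) := by
  have h1 := hΓ.preimage
    (f := fun p : (s.Elem × s.Elem) × (s.Elem × s.Elem) => (p.1.1, p.2.1))
    (by fun_prop) (fun g p => rfl)
  have h2 := hH.2.preimage
    (f := fun p : (s.Elem × s.Elem) × (s.Elem × s.Elem) => (p.2.2, p.2.2, p.2.2))
    (by fun_prop) (fun g p => rfl)
  have h3 := hH.2.preimage
    (f := fun p : (s.Elem × s.Elem) × (s.Elem × s.Elem) => (p.2.1, p.1.2, p.2.2))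
    (by fun_prop) (fun g p => rfl)
  convert ((h1.inter h2).inter h3).proj
  ext ⟨t, w⟩
  constructor
  · rintro ⟨⟨a, b⟩, h4, h⟩
    obtain ⟨rfl, rfl⟩ := Prod.mk.inj h
    refine ⟨((_, _), ((((b⁻¹ : A) : H) : s.Elem), ((1 : H) : s.Elem))),
      ⟨⟨mk_mem_relSet.2 h4, idem_mem_mulGraph.2 rfl⟩, mk_mem_mulGraph.2 (by simp)⟩, rfl⟩
  · rintro ⟨⟨⟨t', u'⟩, v, w⟩, ⟨⟨h4, h5⟩, h6⟩, h⟩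
    obtain ⟨rfl, rfl⟩ := Prod.mk.inj h
    obtain ⟨a, b, h7, rfl, rfl⟩ := mem_relSet.1 h4
    have h5' : w = _ := idem_mem_mulGraph.1 h5
    subst h5'
    obtain ⟨b', c, h8, h9, h10⟩ := mem_mulGraph.1 h6
    dsimp only at h8 h9
    subst h9
    have h11 : b' = b := Subtype.ext h8
    have h12 : b' * c = 1 := Subtype.ext h10
    have h13 : c = ((b⁻¹ : A) : H) := by
      rw [Subgroup.coe_inv, ← h11]
      exact eq_inv_of_mul_eq_one_right h12
    subst h13
    exact mk_mem_relSet.2 (by simpa [mem_relNeg] using h7)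

theorem isStarClosed_relZero (hH : IsStarClosedGroup H) (hA : IsStarClosed G X (subgroupSet A)) :
    IsStarClosed G X (relSet (relZero A)) := by
  have h1 := hA.preimage (f := fun p : s.Elem × s.Elem => p.1)
    (by fun_prop) (fun g p => rfl)
  have h2 := hH.2.preimage (f := fun p : s.Elem × s.Elem => (p.2, p.2, p.2))
    (by fun_prop) (fun g p => rfl)
  convert h1.inter h2
  ext ⟨t, w⟩
  constructor
  · rintro ⟨⟨a, b⟩, h3, h⟩
    obtain ⟨rfl, rfl⟩ := Prod.mk.inj h
    have h3' : b = 1 := h3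
    subst h3'
    exact ⟨⟨a, rfl⟩, idem_mem_mulGraph.2 rfl⟩
  · rintro ⟨⟨a, h3⟩, h4⟩
    have h4' : w = _ := idem_mem_mulGraph.1 h4
    exact mem_relSet.2 ⟨a, 1, rfl, h3, h4'.symm⟩

theorem isStarClosed_relOne (hH : IsStarClosedGroup H) (hA : IsStarClosed G X (subgroupSet A)) :
    IsStarClosed G X (relSet (relOne A)) := by
  have h1 := hA.preimage (f := fun p : (s.Elem × s.Elem) × s.Elem => p.1.1)
    (by fun_prop) (fun g p => rfl)
  have h2 := hH.2.preimage (f := fun p : (s.Elem × s.Elem) × s.Elem => (p.2, p.2, p.2))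
    (by fun_prop) (fun g p => rfl)
  have h3 := hH.2.preimage (f := fun p : (s.Elem × s.Elem) × s.Elem => (p.1.1, p.2, p.1.2))
    (by fun_prop) (fun g p => rfl)
  convert ((h1.inter h2).inter h3).proj
  ext ⟨t, w⟩
  constructor
  · rintro ⟨⟨a, b⟩, h4, h⟩
    obtain ⟨rfl, rfl⟩ := Prod.mk.inj h
    have h4' : a = b := h4
    subst h4'
    exact ⟨((_, _), ((1 : H) : s.Elem)), ⟨⟨⟨a, rfl⟩, idem_mem_mulGraph.2 rfl⟩,
      mk_mem_mulGraph.2 (by rw [mul_one])⟩, rfl⟩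
  · rintro ⟨⟨⟨t', u'⟩, v⟩, ⟨⟨⟨a, h4⟩, h5⟩, h6⟩, h⟩
    obtain ⟨rfl, rfl⟩ := Prod.mk.inj h
    have h5' : v = _ := idem_mem_mulGraph.1 h5
    subst h5'
    dsimp only at h4
    subst h4
    have h6' := mk_mem_mulGraph.1 h6
    rw [mul_one] at h6'
    exact mem_relSet.2 ⟨a, a, rfl, rfl, h6'⟩

theorem isStarClosed_relInv {Γ : Subgroup (A × A)} (hΓ : IsStarClosed G X (relSet Γ)) :
    IsStarClosed G X (relSet (relInv Γ)) := by
  convert hΓ.preimage (f := fun p : s.Elem × s.Elem => (p.2, p.1)) (by fun_prop) (fun g p => rfl)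
  ext ⟨t, w⟩
  constructor
  · rintro ⟨⟨a, b⟩, h4, h⟩
    obtain ⟨rfl, rfl⟩ := Prod.mk.inj h
    exact mk_mem_relSet.2 h4
  · intro h
    obtain ⟨a, b, h1, rfl, rfl⟩ := mem_relSet.1 h
    exact mk_mem_relSet.2 h1

/-- The domain, the kernel and the image of a relation, as subgroups of `H`. -/
theorem isStarClosed_dom {Γ : Subgroup (A × A)} (hΓ : IsStarClosed G X (relSet Γ)) :
    IsStarClosed G X (subgroupSet ((Γ.map (MonoidHom.fst A A)).map A.subtype)) := by
  convert hΓ.proj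
  ext t
  constructor
  · rintro ⟨⟨_, a, ⟨⟨b, c⟩, h1, rfl⟩, rfl⟩, rfl⟩
    exact ⟨(_, _), mk_mem_relSet.2 h1, rfl⟩
  · rintro ⟨⟨t', u⟩, h, rfl⟩
    obtain ⟨a, b, h1, h2, rfl⟩ := mem_relSet.1 h
    exact ⟨⟨a, a, ⟨(a, b), h1, rfl⟩, rfl⟩, h2⟩

theorem isStarClosed_ker (hH : IsStarClosedGroup H) {Γ : Subgroup (A × A)}
    (hΓ : IsStarClosed G X (relSet Γ)) :
    IsStarClosed G X (subgroupSet ((Γ.comap (MonoidHom.inl A A)).map A.subtype)) := by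
  have h2 := hH.2.preimage (f := fun p : s.Elem × s.Elem => (p.2, p.2, p.2))
    (by fun_prop) (fun g p => rfl)
  convert (hΓ.inter h2).proj
  ext t
  constructor
  · rintro ⟨⟨_, a, h1, rfl⟩, rfl⟩
    exact ⟨(_, ((1 : H) : s.Elem)), ⟨mk_mem_relSet.2 h1, idem_mem_mulGraph.2 rfl⟩, rfl⟩
  · rintro ⟨⟨t', u⟩, ⟨h, h'⟩, rfl⟩
    obtain ⟨a, b, h1, h3, rfl⟩ := mem_relSet.1 h
    have h4 : ((b : H) : s.Elem) = _ := idem_mem_mulGraph.1 h'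
    have h5 : b = 1 := Subtype.ext (Subtype.ext h4)
    subst h5
    exact ⟨⟨a, a, h1, rfl⟩, h3⟩

/-- The ring of virtual autogenies of `A`, as a ring of classes of quasi-endomorphisms: the
elements are the classes of `*`-closed quasi-endomorphisms.  See `exists_virtualAutogeny_of_ne_zero`
and `VirtualIsogeny.toRing_ne_zero` for the fact that, for minimal `A`, the nonzero elements are
exactly the classes of virtual autogenies. -/
def autogenySubring (hH : IsStarClosedGroup H) (hA : IsMinimalSubgroup A) :
    Subring (QuasiEndRing A) where
  carrier := {r | ∃ (Γ : Subgroup (A × A)) (hΓ : IsQuasiEnd Γ),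
    IsStarClosed G X (relSet Γ) ∧ r = QuasiEndRing.mk Γ hΓ}
  mul_mem' := by
    rintro _ _ ⟨Γ, hΓ, h, rfl⟩ ⟨Δ, hΔ, h', rfl⟩
    exact ⟨_, _, isStarClosed_relComp h h', QuasiEndRing.mk_mul hΓ hΔ⟩
  one_mem' := ⟨_, _, isStarClosed_relOne hH hA.isStarClosed, rfl⟩
  add_mem' := by
    rintro _ _ ⟨Γ, hΓ, h, rfl⟩ ⟨Δ, hΔ, h', rfl⟩
    exact ⟨_, _, isStarClosed_relAdd hH h h', QuasiEndRing.mk_add hΓ hΔ⟩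
  zero_mem' := ⟨_, _, isStarClosed_relZero hH hA.isStarClosed, rfl⟩
  neg_mem' := by
    rintro _ ⟨Γ, hΓ, h, rfl⟩
    exact ⟨_, _, isStarClosed_relNeg hH h, QuasiEndRing.mk_neg hΓ⟩

/-- The ring `R` of virtual autogenies of `A`. -/
abbrev AutogenyRing (hH : IsStarClosedGroup H) (hA : IsMinimalSubgroup A) : Type _ :=
  autogenySubring hH hA

/-- A `*`-closed quasi-endomorphism of a minimal group which is not commensurable with zero has
finite kernel and image of finite index. -/
theorem finite_ker_of_ne_zero (hH : IsStarClosedGroup H) (hA : IsMinimalSubgroup A)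
    {Γ : Subgroup (A × A)} (hΓ : IsQuasiEnd Γ) (h : IsStarClosed G X (relSet Γ))
    (h0 : QuasiEndRing.mk Γ hΓ ≠ 0) : IsQuasiEnd (relInv Γ) := by
  have hinf := hA.infinite
  have hK : {x : A | (x, (1 : A)) ∈ Γ}.Finite := by
    by_contra hK
    apply h0
    set K : Subgroup A := Γ.comap (MonoidHom.inl A A) with hKdef
    have h1 : (K.map A.subtype).IsFiniteRelIndex A := by
      by_contra h1
      have h2 := hA.finite_of_infinite_index _ (Subgroup.map_subtype_le _)
        (isStarClosed_ker hH h) h1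
      apply hK
      have h3 : Finite K := Finite.of_equiv _
        (K.equivMapOfInjective A.subtype A.subtype_injective).symm.toEquiv
      exact Set.toFinite (K : Set A)
    have h2 : K.FiniteIndex := by
      rw [Subgroup.isFiniteRelIndex_iff_finiteIndex, Subgroup.subgroupOf,
        Subgroup.comap_map_eq_self_of_injective A.subtype_injective] at h1
      exact h1
    have h3 : ((K.map (MonoidHom.inl A A)).map (MonoidHom.fst A A)) = K := by
      rw [Subgroup.map_map]
      exact Subgroup.map_id K
    refine QuasiEndRing.mk_eq_of_le (Θ := K.map (MonoidHom.inl A A)) (by rw [h3]; exact h2) ?_ ?_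
    · exact Subgroup.map_comap_le _ _
    · rintro _ ⟨x, _, rfl⟩
      rfl
  refine ⟨?_, hK⟩
  set I : Subgroup A := (relInv Γ).map (MonoidHom.fst A A) with hIdef
  by_contra hI
  have h1 : ¬ (I.map A.subtype).IsFiniteRelIndex A := by
    rw [Subgroup.isFiniteRelIndex_iff_finiteIndex, Subgroup.subgroupOf,
        Subgroup.comap_map_eq_self_of_injective A.subtype_injective]
    exact hI
  have h2 := hA.finite_of_infinite_index _ (Subgroup.map_subtype_le _)
    (isStarClosed_dom (isStarClosed_relInv h)) h1
  have h3 : Finite I := Finite.of_equiv _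
    (I.equivMapOfInjective A.subtype A.subtype_injective).symm.toEquiv
  have h4 : (↑(Γ.map (MonoidHom.fst A A)) : Set A).Finite := by
    have h5 : ∀ y ∈ (I : Set A), {x : A | (x, y) ∈ Γ}.Finite := by
      intro y hy
      obtain ⟨x0, hx0⟩ := mem_dom.1 hy
      refine (hK.image (fun w => w * x0)).subset ?_
      intro x hx
      refine ⟨x * x0⁻¹, ?_, by simp⟩
      have := Γ.mul_mem hx (Γ.inv_mem hx0)
      simpa using this
    refine ((Set.toFinite (I : Set A)).biUnion h5).subset ?_
    intro x hx
    obtain ⟨y, hy⟩ := mem_dom.1 hx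
    exact Set.mem_biUnion (show y ∈ (I : Set A) from mem_dom.2 ⟨x, hy⟩) hy
  have h5 := hΓ.dom
  have h6 : Finite (Γ.map (MonoidHom.fst A A)) := h4.to_subtype
  have : Finite A := Subgroup.finite_iff_finite_and_finiteIndex (Γ.map (MonoidHom.fst A A)) |>.2
    ⟨h6, h5⟩
  exact not_finite A

theorem autogenyRing_isUnit_or_eq_zero (hH : IsStarClosedGroup H) (hA : IsMinimalSubgroup A)
    (r : AutogenyRing hH hA) : IsUnit r ∨ r = 0 := by
  obtain ⟨_, Γ, hΓ, h, rfl⟩ := r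
  by_cases h0 : QuasiEndRing.mk Γ hΓ = 0
  · exact Or.inr (Subtype.ext h0)
  left
  have h1 := finite_ker_of_ne_zero hH hA hΓ h h0
  refine ⟨⟨⟨_, Γ, hΓ, h, rfl⟩, ⟨QuasiEndRing.mk (relInv Γ) h1, relInv Γ, h1,
    isStarClosed_relInv h, rfl⟩, Subtype.ext ?_, Subtype.ext ?_⟩, rfl⟩
  · change QuasiEndRing.mk Γ hΓ * QuasiEndRing.mk (relInv Γ) h1 = 1
    rw [QuasiEndRing.mk_mul, QuasiEndRing.one_def]
    refine QuasiEndRing.mk_eq_of_le (Θ := relComp Γ (relInv Γ) ⊓ relOne A) ?_ inf_le_left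
      inf_le_right
    have := h1.dom
    refine Subgroup.finiteIndex_of_le (H := (relInv Γ).map (MonoidHom.fst A A)) ?_
    intro y hy
    obtain ⟨x, hx⟩ := mem_dom.1 hy
    exact mem_dom.2 ⟨y, ⟨x, hx, hx⟩, rfl⟩
  · change QuasiEndRing.mk (relInv Γ) h1 * QuasiEndRing.mk Γ hΓ = 1
    rw [QuasiEndRing.mk_mul, QuasiEndRing.one_def]
    refine QuasiEndRing.mk_eq_of_le (Θ := relComp (relInv Γ) Γ ⊓ relOne A) ?_ inf_le_left
      inf_le_right
    have := hΓ.dom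
    refine Subgroup.finiteIndex_of_le (H := Γ.map (MonoidHom.fst A A)) ?_
    intro y hy
    obtain ⟨x, hx⟩ := mem_dom.1 hy
    exact mem_dom.2 ⟨y, ⟨x, hx, hx⟩, rfl⟩

theorem quasiEnd_mk_ne_zero (hA : IsMinimalSubgroup A) {Γ : Subgroup (A × A)} (hΓ : IsQuasiEnd Γ)
    (hΓ' : IsQuasiEnd (relInv Γ)) : QuasiEndRing.mk Γ hΓ ≠ 0 := by
  intro h
  rw [QuasiEndRing.zero_def, QuasiEndRing.mk_eq_mk] at h
  have h1 := (hΓ.inf h).dom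
  have h2 : Finite ((Γ ⊓ relZero A).map (MonoidHom.fst A A)) := by
    refine Set.Finite.to_subtype (hΓ'.indet.subset ?_)
    intro x hx
    obtain ⟨y, hy, hy'⟩ := mem_dom.1 hx
    have hy'' : y = 1 := hy'
    subst hy''
    exact hy
  have := hA.infinite
  have : Finite A := Subgroup.finite_iff_finite_and_finiteIndex
    ((Γ ⊓ relZero A).map (MonoidHom.fst A A)) |>.2 ⟨h2, h1⟩
  exact not_finite A

/-- For a minimal abelian group `A`, the ring of virtual autogenies is a division ring. -/
noncomputable instance (hH : IsStarClosedGroup H) (hA : IsMinimalSubgroup A) :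
    DivisionRing (AutogenyRing hH hA) :=
  have : Nontrivial (AutogenyRing hH hA) := by
    refine ⟨1, 0, fun h => ?_⟩
    refine quasiEnd_mk_ne_zero hA (isQuasiEnd_relOne A) ?_ (congrArg Subtype.val h)
    convert isQuasiEnd_relOne A
    ext p
    exact eq_comm
  DivisionRing.ofIsUnitOrEqZero (autogenyRing_isUnit_or_eq_zero hH hA)

end Closedness

/-! ## Virtual autogenies as elements of the ring -/

section Classes

variable [CompactSpace X] [IsMulCommutative A]

/-- The topology induced on a `*`-closed subgroup is a compact group topology. -/
theorem compactSpace_of_isStarClosed (hA : IsStarClosed G X (subgroupSet A)) :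
    CompactSpace A := by
  obtain ⟨P, hP, hA, -⟩ := hA
  have h1 : Topology.IsEmbedding (fun a : A => ((a : H) : s.Elem)) :=
    Topology.IsEmbedding.subtypeVal.comp Topology.IsEmbedding.subtypeVal
  exact (Topology.IsClosedEmbedding.mk h1 hA).compactSpace

theorem continuous_of_isClosed_rel {Y Z : Type*} [TopologicalSpace Y] [TopologicalSpace Z]
    [CompactSpace Z] {f : Y → Z} (h : IsClosed {p : Y × Z | f p.1 = p.2}) : Continuous f := by
  rw [continuous_iff_isClosed]
  intro S hS
  have h1 := isClosedMap_fst_of_compactSpace _ (h.inter (hS.preimage continuous_snd))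
  convert h1
  ext y
  constructor
  · intro hy
    exact ⟨(y, f y), ⟨rfl, hy⟩, rfl⟩
  · rintro ⟨⟨y, z⟩, ⟨h2, h3⟩, rfl⟩
    have h2' : f y = z := h2
    subst h2'
    exact h3

theorem isTopologicalGroup_of_isStarClosed (hH : IsStarClosedGroup H)
    (hA : IsStarClosed G X (subgroupSet A)) : IsTopologicalGroup A := by
  have := compactSpace_of_isStarClosed hA
  obtain ⟨-, P, hP, hM, -⟩ := hH
  refine { continuous_mul := ?_, continuous_inv := ?_ }
  · apply continuous_of_isClosed_rel
    convert hM.preimage (f := fun p : (A × A) × A => (((p.1.1 : H) : s.Elem),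
      ((p.1.2 : H) : s.Elem), ((p.2 : H) : s.Elem))) (by fun_prop)
    ext ⟨⟨a, b⟩, c⟩
    rw [Set.mem_preimage, mk_mem_mulGraph]
    constructor
    · intro h
      exact congrArg (fun z : A => ((z : H) : s.Elem)) h
    · intro h
      exact Subtype.ext (Subtype.ext h)
  · apply continuous_of_isClosed_rel
    convert hM.preimage (f := fun p : A × A => (((p.1 : H) : s.Elem),
      ((p.2 : H) : s.Elem), ((1 : H) : s.Elem))) (by fun_prop)
    ext ⟨a, b⟩
    rw [Set.mem_preimage, mk_mem_mulGraph]
    constructor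
    · intro h
      have h' : a⁻¹ = b := h
      subst h'
      simp
    · intro h
      have h1 : (a : H) * b = 1 := Subtype.ext h
      have h2 : a * b = 1 := Subtype.ext h1
      exact inv_eq_of_mul_eq_one_right h2

theorem mem_sectionGraph {A B : Type*} [CommGroup A] [CommGroup B] {D K : Subgroup A}
    {I C : Subgroup B} {f : (D ⧸ K.subgroupOf D) ≃* (I ⧸ C.subgroupOf I)} {p : A × B} :
    p ∈ sectionGraph f ↔ ∃ (hx : p.1 ∈ D) (hy : p.2 ∈ I),
      f (QuotientGroup.mk ⟨p.1, hx⟩) = QuotientGroup.mk ⟨p.2, hy⟩ := Iff.rfl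

theorem VirtualIsogeny.isQuasiEnd_graph (hH : IsStarClosedGroup H) (hA : IsMinimalSubgroup A)
    (f : VirtualAutogeny A) : IsQuasiEnd f.graph ∧ IsQuasiEnd (relInv f.graph) := by
  have := compactSpace_of_isStarClosed hA.isStarClosed
  have := isTopologicalGroup_of_isStarClosed hH hA.isStarClosed
  have hD : f.D.FiniteIndex := by
    have := Subgroup.quotient_finite_of_isOpen f.D f.isOpen_D
    exact Subgroup.finiteIndex_of_finite_quotient
  have hI : f.I.FiniteIndex := by
    have := Subgroup.quotient_finite_of_isOpen f.I f.isOpen_I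
    exact Subgroup.finiteIndex_of_finite_quotient
  have hK := f.finite_K
  have hC := f.finite_C
  refine ⟨⟨Subgroup.finiteIndex_of_le (H := f.D) ?_, ?_⟩,
    ⟨Subgroup.finiteIndex_of_le (H := f.I) ?_, ?_⟩⟩
  · intro x hx
    obtain ⟨y, hy⟩ := QuotientGroup.mk_surjective (f.iso (QuotientGroup.mk ⟨x, hx⟩))
    exact mem_dom.2 ⟨y, hx, y.2, hy.symm⟩
  · refine (Set.toFinite (f.C : Set A)).subset ?_
    rintro y ⟨h1, h2, h3⟩
    have h4 : f.iso (QuotientGroup.mk ⟨1, h1⟩) = 1 := map_one f.iso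
    rw [h3] at h4
    exact (QuotientGroup.eq_one_iff (N := f.C.subgroupOf f.I) ⟨y, h2⟩).1 h4
  · intro y hy
    obtain ⟨x, hx⟩ := QuotientGroup.mk_surjective (f.iso.symm (QuotientGroup.mk ⟨y, hy⟩))
    refine mem_dom.2 ⟨x, x.2, hy, ?_⟩
    change f.iso (QuotientGroup.mk x) = _
    rw [hx, MulEquiv.apply_symm_apply]
  · refine (Set.toFinite (f.K : Set A)).subset ?_
    rintro x ⟨h1, h2, h3⟩
    have h4 : (QuotientGroup.mk ⟨1, h2⟩ : f.I ⧸ f.C.subgroupOf f.I) = 1 := rfl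
    have h5 := h3.trans h4
    rw [map_eq_one_iff _ f.iso.injective] at h5
    exact (QuotientGroup.eq_one_iff (N := f.K.subgroupOf f.D) ⟨x, h1⟩).1 h5

/-- The element of the ring given by a virtual autogeny. -/
def VirtualIsogeny.toRing (hH : IsStarClosedGroup H) (hA : IsMinimalSubgroup A)
    (f : VirtualAutogeny A) : AutogenyRing hH hA :=
  ⟨QuasiEndRing.mk f.graph (f.isQuasiEnd_graph hH hA).1,
    f.graph, (f.isQuasiEnd_graph hH hA).1, f.isStarClosed, rfl⟩

/-- Virtual autogenies give the same element iff they are equivalent. -/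
theorem VirtualIsogeny.toRing_eq_iff (hH : IsStarClosedGroup H) (hA : IsMinimalSubgroup A)
    (f g : VirtualAutogeny A) : f.toRing hH hA = g.toRing hH hA ↔ f.Equivalent g :=
  Subtype.ext_iff.trans QuasiEndRing.mk_eq_mk

theorem VirtualIsogeny.toRing_ne_zero (hH : IsStarClosedGroup H) (hA : IsMinimalSubgroup A)
    (f : VirtualAutogeny A) : f.toRing hH hA ≠ 0 := fun h =>
  quasiEnd_mk_ne_zero hA (f.isQuasiEnd_graph hH hA).1 (f.isQuasiEnd_graph hH hA).2
    (congrArg Subtype.val h)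

/-- A `*`-closed quasi-endomorphism whose converse is a quasi-endomorphism is the graph of a
virtual autogeny. -/
theorem exists_virtualAutogeny_of_graph (hH : IsStarClosedGroup H) (hA : IsMinimalSubgroup A)
    {Γ : Subgroup (A × A)} (hΓ : IsQuasiEnd Γ) (hΓ' : IsQuasiEnd (relInv Γ))
    (h : IsStarClosed G X (relSet Γ)) : ∃ f : VirtualAutogeny A, f.graph = Γ := by
  have := compactSpace_of_isStarClosed hA.isStarClosed
  have := isTopologicalGroup_of_isStarClosed hH hA.isStarClosed
  have hop : ∀ {Δ : Subgroup (A × A)}, IsQuasiEnd Δ → IsStarClosed G X (relSet Δ) →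
      IsOpen ((Δ.map (MonoidHom.fst A A) : Subgroup A) : Set A) := by
    intro Δ hΔ hΔc
    have := hΔ.dom
    apply Subgroup.isOpen_of_isClosed_of_finiteIndex
    obtain ⟨P, hP, h1, -⟩ := isStarClosed_dom hΔc
    convert h1.preimage (f := fun a : A => ((a : H) : s.Elem)) (by fun_prop)
    ext a
    rw [Set.mem_preimage, coe_mem_subgroupSet]
    simp
  set D : Subgroup A := Γ.map (MonoidHom.fst A A)
  set I : Subgroup A := (relInv Γ).map (MonoidHom.fst A A)
  set K : Subgroup A := Γ.comap (MonoidHom.inl A A)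
  set C : Subgroup A := Γ.comap (MonoidHom.inr A A)
  have hKD : K ≤ D := fun x hx => mem_dom.2 ⟨1, hx⟩
  have hCI : C ≤ I := fun y hy => mem_dom.2 ⟨1, hy⟩
  let F : Γ →* I ⧸ C.subgroupOf I := (QuotientGroup.mk' _).comp
    (((MonoidHom.snd A A).comp Γ.subtype).codRestrict I
      (fun p => mem_dom.2 ⟨p.1.1, p.2⟩))
  let E : Γ →* D ⧸ K.subgroupOf D := (QuotientGroup.mk' _).comp
    (((MonoidHom.fst A A).comp Γ.subtype).codRestrict D
      (fun p => mem_dom.2 ⟨p.1.2, p.2⟩))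
  have hF : Function.Surjective F := by
    intro q
    obtain ⟨⟨y, hy⟩, rfl⟩ := QuotientGroup.mk_surjective q
    obtain ⟨x, hx⟩ := mem_dom.1 hy
    exact ⟨⟨(x, y), hx⟩, rfl⟩
  have hE : Function.Surjective E := by
    intro q
    obtain ⟨⟨x, hx⟩, rfl⟩ := QuotientGroup.mk_surjective q
    obtain ⟨y, hy⟩ := mem_dom.1 hx
    exact ⟨⟨(x, y), hy⟩, rfl⟩
  have hFker : ∀ p : Γ, F p = 1 ↔ ((1 : A), p.1.2) ∈ Γ := fun p => QuotientGroup.eq_one_iff _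
  have hEker : ∀ p : Γ, E p = 1 ↔ (p.1.1, (1 : A)) ∈ Γ := fun p => QuotientGroup.eq_one_iff _
  have hFE : E.ker = F.ker := by
    ext p
    rw [MonoidHom.mem_ker, MonoidHom.mem_ker, hFker, hEker]
    constructor
    · intro h1
      have := Γ.mul_mem p.2 (Γ.inv_mem h1)
      simpa [Prod.ext_iff, Prod.mul_def] using this
    · intro h1
      have := Γ.mul_mem p.2 (Γ.inv_mem h1)
      simpa [Prod.ext_iff, Prod.mul_def] using this
  let φ : (D ⧸ K.subgroupOf D) ≃* (I ⧸ C.subgroupOf I) :=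
    (QuotientGroup.quotientKerEquivOfSurjective E hE).symm.trans
      ((QuotientGroup.quotientMulEquivOfEq hFE).trans
        (QuotientGroup.quotientKerEquivOfSurjective F hF))
  have hφ : ∀ p : Γ, φ (E p) = F p := by
    intro p
    have h1 : (QuotientGroup.quotientKerEquivOfSurjective E hE).symm (E p) =
        QuotientGroup.mk p := by
      rw [MulEquiv.symm_apply_eq]
      rfl
    change QuotientGroup.quotientKerEquivOfSurjective F hF (QuotientGroup.quotientMulEquivOfEq hFE
      ((QuotientGroup.quotientKerEquivOfSurjective E hE).symm (E p))) = F p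
    rw [h1]
    rfl
  have hgraph : sectionGraph φ = Γ := by
    ext ⟨x, y⟩
    rw [mem_sectionGraph]
    constructor
    · rintro ⟨hx, hy, h1⟩
      obtain ⟨y', hy'⟩ := mem_dom.1 hx
      have h2 := hφ ⟨(x, y'), hy'⟩
      have h3 : F ⟨(x, y'), hy'⟩ = QuotientGroup.mk ⟨y, hy⟩ := h2.symm.trans h1
      have h4 := (QuotientGroup.eq.1 h3 : _ ∈ C.subgroupOf I)
      have h5 : ((1 : A), y'⁻¹ * y) ∈ Γ := h4
      have := Γ.mul_mem hy' h5
      simpa using this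
    · intro hxy
      exact ⟨mem_dom.2 ⟨y, hxy⟩, mem_dom.2 ⟨x, hxy⟩, hφ ⟨(x, y), hxy⟩⟩
  refine ⟨{ D := D, K := K, I := I, C := C, isOpen_D := hop hΓ h,
            isOpen_I := hop hΓ' (isStarClosed_relInv h), K_le_D := hKD, C_le_I := hCI,
            finite_K := hΓ'.indet.to_subtype, finite_C := hΓ.indet.to_subtype,
            iso := φ, isStarClosed := by rw [hgraph]; exact h }, hgraph⟩

/-- Every nonzero element of the ring is the class of a virtual autogeny. -/
theorem exists_virtualAutogeny_of_ne_zero (hH : IsStarClosedGroup H) (hA : IsMinimalSubgroup A)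
    (r : AutogenyRing hH hA) (hr : r ≠ 0) : ∃ f : VirtualAutogeny A, f.toRing hH hA = r := by
  obtain ⟨_, Γ, hΓ, h, rfl⟩ := r
  have h0 : QuasiEndRing.mk Γ hΓ ≠ 0 := fun h0 => hr (Subtype.ext h0)
  obtain ⟨f, rfl⟩ := exists_virtualAutogeny_of_graph hH hA hΓ
    (finite_ker_of_ne_zero hH hA hΓ h h0) h
  exact ⟨f, rfl⟩

end Classes

end AutogenyRing

/-! ## Groups of automorphisms with countably many orbits -/

section CountablyManyOrbits

open Topology

/-! Let `K` be the pointwise stabilizer of finitely many parameters over which the multiplication of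
`H`, the set `A` and chosen relations representing finitely many elements of the ring are closed.
Then `K` acts on `A` by automorphisms preserving these relations, and by smallness the stabilizer in
`K` of any finite subset of `A` has only countably many orbits on `A`. By Baire, the infinite
compact group `A` is uncountable.

The relations are partial and multivalued, so two subgroups are needed to control them. The
relations can be composed freely on some uncountable subgroup `D`
(`exists_uncountable_subgroup_total`), because all displacements `k • x / x`, for `k` fixing a
suitable finite set, lie in it. The least subgroup `C` closed under the relations is finite
(`finite_relClosure`): otherwise its topological closure has finite index by minimality, while
elements of `K` close to the identity fix it pointwise, which makes it countable. For each `b`, the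
elements `x` with `k • x / x ∈ C` whenever `k` fixes `b` then form a closed countable, hence finite,
subgroup `B` that contains `b` and is closed under the relations
(`exists_finite_subgroup_closed_under_rel`).

Take `b ∈ D` with infinite `K`-orbit. Every element of the generated subring has a `K`-invariant
representative with a value at `b`, and this value lies in the finite group `B`. The value
determines the element: if two agree, the kernel of the difference is `K`-invariant and contains
`b`, so it is infinite, whereas a nonzero class has finite kernel (`finite_ker_of_ne_zero`). This
gives local finiteness (`autogenyRing_finite_closure`).

For the conjugates, Wedderburn's theorem makes the locally finite division ring a field, and the
class of `f` satisfies some equation `x ^ p = x ^ q` with `p < q`. Conjugation is multiplicative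
(`QuasiEndRing.conj`), so the classes of all conjugates satisfy the same equation, which has
finitely many roots. -/

theorem finite_of_countable_of_compactSpace {A : Type*} [Group A] [TopologicalSpace A]
    [IsTopologicalGroup A] [CompactSpace A] [T2Space A] [Countable A] : Finite A := by
  -- By Baire, one of the countably many singletons has nonempty interior; translating it to `1`
  -- shows that the topology is discrete.
  obtain ⟨a, b, hb⟩ := nonempty_interior_of_iUnion_of_closed (f := fun a : A => ({a} : Set A))
    (fun _ => isClosed_singleton) (by ext; simp)
  have hb' : b = a := interior_subset (s := {a}) hb
  subst hb'
  have h1 : IsOpen ({b} : Set A) := by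
    rw [← interior_eq_iff_isOpen]
    exact interior_subset.antisymm (Set.singleton_subset_iff.2 hb)
  have h2 : IsOpen ({1} : Set A) := by
    convert h1.preimage (continuous_const_mul b)
    ext
    simp
  have := discreteTopology_of_isOpen_singleton_one h2
  exact finite_of_compact_of_discrete

theorem Subgroup.finite_of_isClosed_of_countable {A : Type*} [Group A] [TopologicalSpace A]
    [IsTopologicalGroup A] [CompactSpace A] [T2Space A] {B : Subgroup A}
    (hB : IsClosed (B : Set A)) (h : (B : Set A).Countable) : (B : Set A).Finite := by
  have : CompactSpace B := isCompact_iff_compactSpace.1 hB.isCompact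
  have : Countable B := h.to_subtype
  have : Finite B := finite_of_countable_of_compactSpace
  exact Set.toFinite _

theorem Subgroup.countable_of_finiteIndex {A : Type*} [Group A] {B : Subgroup A}
    (hB : B.FiniteIndex) (h : (B : Set A).Countable) : Countable A := by
  have h1 : (⋃ q : A ⧸ B, (fun b => q.out * b) '' (B : Set A)).Countable :=
    Set.countable_iUnion fun q => h.image _
  rw [← Set.countable_univ_iff]
  refine h1.mono fun a _ => Set.mem_iUnion.2 ⟨QuotientGroup.mk a, ?_⟩
  exact ⟨(Quotient.out (a : A ⧸ B))⁻¹ * a, QuotientGroup.eq.1 (QuotientGroup.out_eq' _),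
    mul_inv_cancel_left _ _⟩

/-- A nonempty fibre is a coset of the indeterminacy. -/
theorem finite_fiber_of_finite_indet {A : Type*} [CommGroup A] {Γ : Subgroup (A × A)}
    (hΓ : {y : A | ((1 : A), y) ∈ Γ}.Finite) (x : A) : {y : A | (x, y) ∈ Γ}.Finite := by
  by_cases hx : ∃ y₀, (x, y₀) ∈ Γ
  · obtain ⟨y₀, hy₀⟩ := hx
    refine (hΓ.image fun w => w * y₀).subset ?_
    intro y hy
    refine ⟨y / y₀, ?_, by simp⟩
    simpa using Γ.div_mem hy hy₀
  · push Not at hx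
    simp [hx]

variable {K A ι : Type*} [Group K] [CommGroup A] [MulDistribMulAction K A]

variable (K A) in
/-- For every finite set of elements of `A`, its pointwise stabilizer in `K` has only countably
many orbits on `A`. -/
def HasCountablyManyOrbitsOverFinite : Prop :=
  ∀ F : Set A, F.Finite → ∃ T : Set A, T.Countable ∧
    ∀ x, ∃ t ∈ T, ∃ k : K, (∀ e ∈ F, k • e = e) ∧ k • t = x

/-- The elements of `D` at which all the relations `Γ i` have a value in `D`. -/
def restrictDom (Γ : ι → Subgroup (A × A)) (D : Subgroup A) : Subgroup A :=
  D ⊓ ⨅ i, (Γ i ⊓ D.comap (MonoidHom.snd A A)).map (MonoidHom.fst A A)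

theorem mem_restrictDom {Γ : ι → Subgroup (A × A)} {D : Subgroup A} {x : A} :
    x ∈ restrictDom Γ D ↔ x ∈ D ∧ ∀ i, ∃ y ∈ D, (x, y) ∈ Γ i := by
  simp only [restrictDom, Subgroup.mem_inf, Subgroup.mem_iInf, mem_dom]
  refine and_congr_right fun _ => forall_congr' fun i => exists_congr fun y => ?_
  exact and_comm

/-- Finitely many invariant quasi-endomorphisms of an uncountable group `A` have a common
uncountable subgroup on which all their compositions are defined. -/
theorem exists_uncountable_subgroup_total [Finite ι] [Uncountable A]
    (horb : HasCountablyManyOrbitsOverFinite K A) {Γ : ι → Subgroup (A × A)}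
    (hΓ : ∀ i, IsQuasiEnd (Γ i))
    (hinv : ∀ i (k : K) x y, (x, y) ∈ Γ i → (k • x, k • y) ∈ Γ i) :
    ∃ D : Subgroup A, ¬ (D : Set A).Countable ∧ ∀ x ∈ D, ∀ i, ∃ y ∈ D, (x, y) ∈ Γ i := by
  have hdom (i : ι) := (hΓ i).dom
  let D₁ : Subgroup A := ⨅ i, (Γ i).map (MonoidHom.fst A A)
  have hD₁ : D₁.FiniteIndex := Subgroup.finiteIndex_iInf fun i => inferInstance
  -- A finite transversal of the common domain. Orbits are taken over `E`, so that the automorphisms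
  -- used below fix every coset representative.
  let E : Set A := Set.range fun q : A ⧸ D₁ => q.out
  obtain ⟨T, hT, hTorb⟩ := horb E (Set.finite_range _)
  let D : ℕ → Subgroup A := fun n => (restrictDom Γ)^[n] ⊤
  have hDsucc (n : ℕ) : D (n + 1) = restrictDom Γ (D n) := Function.iterate_succ_apply' _ _ _
  have hanti : Antitone D := antitone_nat_of_succ_le fun n => by
    rw [hDsucc]
    exact inf_le_left
  -- Write `x = e * d` with `e ∈ E` and `d ∈ D₁`. As `k` fixes `e`, the displacements of `x` and `d`
  -- agree, and if `z` is a value of `Γ i` at `d`, then `k • z / z` is a value at this displacement.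
  -- It lies in `D n` by induction, which is why the claim is made for all elements at once.
  have hmove (k : K) (hk : ∀ e ∈ E, k • e = e) (n : ℕ) : ∀ x : A, k • x / x ∈ D n := by
    induction n with
    | zero => exact fun x => Subgroup.mem_top _
    | succ n ih =>
      intro x
      rw [hDsucc, mem_restrictDom]
      refine ⟨ih x, fun i => ?_⟩
      set e : A := Quotient.out (x : A ⧸ D₁)
      have hd : e⁻¹ * x ∈ D₁ := QuotientGroup.eq.1 (QuotientGroup.out_eq' _)
      obtain ⟨z, hz⟩ := mem_dom.1 (Subgroup.mem_iInf.1 hd i)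
      refine ⟨k • z / z, ih z, ?_⟩
      have h1 := (Γ i).div_mem (hinv i k _ _ hz) hz
      have h2 : k • (e⁻¹ * x) / (e⁻¹ * x) = k • x / x := by
        rw [smul_mul', smul_inv', hk e ⟨_, rfl⟩, mul_div_mul_left_eq_div]
      rwa [Prod.mk_div_mk, h2] at h1
  refine ⟨⨅ n, D n, fun hc => ?_, fun x hx i => ?_⟩
  -- Every `x` is `k • t` with `t ∈ T`, hence a displacement times `t`, so a countable intersection
  -- would make `A` countable.
  · have h1 : (⋃ t ∈ T, (fun d => d * t) '' ((⨅ n, D n : Subgroup A) : Set A)).Countable :=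
      hT.biUnion fun t _ => hc.image _
    refine not_countable (α := A) (Set.countable_univ_iff.1 (h1.mono fun x _ => ?_))
    obtain ⟨t, ht, k, hk, rfl⟩ := hTorb x
    exact Set.mem_biUnion ht ⟨k • t / t, Subgroup.mem_iInf.2 fun n => hmove k hk n t, by simp⟩
  · by_contra! h
    -- If each of the finitely many values at `x` left the decreasing chain, all would be outside a
    -- common `D n`, contradicting `x ∈ D (n + 1)`.
    have hfin := finite_fiber_of_finite_indet (hΓ i).indet x
    have h1 : ∀ᶠ n in Filter.atTop, ∀ y ∈ {y : A | (x, y) ∈ Γ i}, y ∉ D n := by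
      rw [Filter.eventually_all_finite hfin]
      intro y hy
      have h2 : ¬ ∀ n, y ∈ D n := fun h3 => h y (Subgroup.mem_iInf.2 h3) hy
      push Not at h2
      obtain ⟨n, hn⟩ := h2
      exact Filter.eventually_atTop.2 ⟨n, fun m hm hym => hn (hanti hm hym)⟩
    obtain ⟨n, hn⟩ := h1.exists
    have hx' := Subgroup.mem_iInf.1 hx (n + 1)
    rw [hDsucc, mem_restrictDom] at hx'
    obtain ⟨y, hy, hxy⟩ := hx'.2 i
    exact hn y hxy hy

/-- The least subgroup closed under all the relations `Γ i`. -/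
def relClosure (Γ : ι → Subgroup (A × A)) : Subgroup A :=
  sInf {C | ∀ i, ∀ x ∈ C, ∀ y, (x, y) ∈ Γ i → y ∈ C}

theorem relClosure_le {Γ : ι → Subgroup (A × A)} {C : Subgroup A}
    (h : ∀ i, ∀ x ∈ C, ∀ y, (x, y) ∈ Γ i → y ∈ C) : relClosure Γ ≤ C := sInf_le h

theorem mem_relClosure_of_rel {Γ : ι → Subgroup (A × A)} {i : ι} {x y : A}
    (hx : x ∈ relClosure Γ) (hxy : (x, y) ∈ Γ i) : y ∈ relClosure Γ :=
  Subgroup.mem_sInf.2 fun C hC => hC i x (Subgroup.mem_sInf.1 hx C hC) y hxy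

/-- By invariance, the preimage of the closure under `k` is again closed under the relations, so it
contains the least such subgroup. -/
theorem smul_mem_relClosure {Γ : ι → Subgroup (A × A)}
    (hinv : ∀ i (k : K) x y, (x, y) ∈ Γ i → (k • x, k • y) ∈ Γ i) (k : K) {x : A}
    (hx : x ∈ relClosure Γ) : k • x ∈ relClosure Γ :=
  relClosure_le (C := (relClosure Γ).comap (MulDistribMulAction.toMonoidHom A k))
    (fun i _ hx _ hxy => mem_relClosure_of_rel hx (hinv i k _ _ hxy)) hx

variable [TopologicalSpace A] [IsTopologicalGroup A] [T2Space A]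
  [ContinuousConstSMul K A]

variable (K A) in
/-- For every neighbourhood `U` of `1`, countably many translates of the set of all `k` which move
every element of `A` within `U` cover `K`. -/
def IsUniformlySeparable : Prop :=
  ∀ U ∈ 𝓝 (1 : A), ∃ T : Set K, T.Countable ∧
    ∀ k : K, ∃ t ∈ T, ∃ w : K, (∀ x : A, w • x / x ∈ U) ∧ k = t * w

/-- If the closed invariant subgroups are finite or of finite index, then finitely many invariant
relations with finite indeterminacies have a finite closure. -/
theorem finite_relClosure [Finite ι] [Uncountable A]
    (horb : HasCountablyManyOrbitsOverFinite K A) (hsep : IsUniformlySeparable K A)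
    (hmin : ∀ B : Subgroup A, IsClosed (B : Set A) → (∀ (k : K), ∀ x ∈ B, k • x ∈ B) →
      (B : Set A).Finite ∨ B.FiniteIndex)
    {Γ : ι → Subgroup (A × A)} (hΓ : ∀ i, {y : A | ((1 : A), y) ∈ Γ i}.Finite)
    (hinv : ∀ i (k : K) x y, (x, y) ∈ Γ i → (k • x, k • y) ∈ Γ i) :
    (relClosure Γ : Set A).Finite := by
  set C := relClosure Γ
  have hclinv (k : K) : ∀ x ∈ C.topologicalClosure, k • x ∈ C.topologicalClosure := by
    intro x hx
    exact map_mem_closure (continuous_const_smul k) hx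
      fun y hy => smul_mem_relClosure hinv k hy
  rcases hmin C.topologicalClosure C.isClosed_topologicalClosure hclinv with h | h
  · exact h.subset C.le_topologicalClosure
  exfalso
  -- The nontrivial elements of the indeterminacies. The set `N` is finite, so its complement is a
  -- neighbourhood of `1`.
  let N : Set A := (⋃ i, {y : A | ((1 : A), y) ∈ Γ i}) \ {1}
  have hN : N.Finite := (Set.finite_iUnion hΓ).subset Set.sdiff_subset
  obtain ⟨T, hT, hTK⟩ := hsep Nᶜ (hN.isClosed.isOpen_compl.mem_nhds (by simp [N]))
  -- The fixed points of `w` are closed under every `Γ i`: if `w` fixes `x` and `y` is a value at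
  -- `x`, then so is `w • y`, hence `w • y / y` lies in the indeterminacy; avoiding `N`, it must be
  -- `1`. So `w` fixes `relClosure Γ`, and by continuity its topological closure.
  have hfix (w : K) (hw : ∀ x : A, w • x / x ∈ Nᶜ) : ∀ x ∈ C.topologicalClosure, w • x = x := by
    have h1 : C ≤ FixedPoints.subgroup (Subgroup.zpowers w) A := by
      refine relClosure_le fun i x hx y hxy => ?_
      rintro ⟨k, hk⟩
      have h2 : w • y = y := by
        have h3 : w • x = x := hx ⟨w, Subgroup.mem_zpowers w⟩
        have h4 := (Γ i).div_mem (hinv i w _ _ hxy) hxy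
        rw [h3, Prod.mk_div_mk, div_self'] at h4
        by_contra h5
        exact hw y ⟨Set.mem_iUnion.2 ⟨i, h4⟩, fun h6 => h5 (div_eq_one.1 h6)⟩
      have h3 : Subgroup.zpowers w ≤ MulAction.stabilizer K y := by
        rwa [Subgroup.zpowers_le]
      exact h3 hk
    intro x hx
    have h2 : IsClosed {x : A | w • x = x} := isClosed_eq (continuous_const_smul w) continuous_id
    exact closure_minimal (fun y hy => h1 hy ⟨w, Subgroup.mem_zpowers w⟩) h2 hx
  obtain ⟨S, hS, hSorb⟩ := horb ∅ Set.finite_empty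
  refine not_countable (α := A) (Subgroup.countable_of_finiteIndex h ?_)
  -- An element of the topological closure is `(t * w) • s = t • s`, since `w` fixes `s`; there are
  -- countably many such pairs `(t, s)`.
  have h1 : (⋃ s ∈ S, (fun t : K => t • s) '' T).Countable := hS.biUnion fun s _ => hT.image _
  refine h1.mono fun x hx => ?_
  obtain ⟨s, hs, k, -, rfl⟩ := hSorb x
  obtain ⟨t, ht, w, hw, rfl⟩ := hTK k
  have h2 : s ∈ C.topologicalClosure := by
    have := hclinv (t * w)⁻¹ _ hx
    rwa [inv_smul_smul] at this
  exact Set.mem_biUnion hs ⟨t, ht, by rw [mul_smul, hfix w hw s h2]⟩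

/-- If invariant relations have a finite closure, then every element lies in a finite subgroup
closed under these relations. -/
theorem exists_finite_subgroup_closed_under_rel [CompactSpace A]
    (horb : HasCountablyManyOrbitsOverFinite K A) {Γ : ι → Subgroup (A × A)}
    (hinv : ∀ i (k : K) x y, (x, y) ∈ Γ i → (k • x, k • y) ∈ Γ i)
    (hC : (relClosure Γ : Set A).Finite) (b : A) :
    ∃ B : Subgroup A, (B : Set A).Finite ∧ b ∈ B ∧ ∀ i, ∀ x ∈ B, ∀ y, (x, y) ∈ Γ i → y ∈ B := by
  set C := relClosure Γ
  let φ (k : K) : A →* A := MulDistribMulAction.toMonoidHom A k / MonoidHom.id A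
  -- Modulo `C`, these are the elements fixed by the stabilizer of `b`.
  let B : Subgroup A := ⨅ k : MulAction.stabilizer K b, C.comap (φ k)
  have hB (x : A) : x ∈ B ↔ ∀ k : K, k • b = b → k • x / x ∈ C := by
    simp only [B, Subgroup.mem_iInf, Subtype.forall, MulAction.mem_stabilizer_iff]
    rfl
  refine ⟨B, Subgroup.finite_of_isClosed_of_countable ?_ ?_, ?_, ?_⟩
  · have : (B : Set A) = ⋂ k : MulAction.stabilizer K b, (fun x => k.1 • x / x) ⁻¹' C := by
      ext x
      simp only [B, SetLike.mem_coe, Subgroup.mem_iInf, Set.mem_iInter]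
      rfl
    rw [this]
    refine isClosed_iInter fun k => hC.isClosed.preimage ?_
    exact (continuous_const_smul k.1).div' continuous_id
  -- If `x ∈ B` is the image of `t` under an element fixing `b`, then `t / x ∈ C`. So `B` is covered
  -- by countably many finite sets.
  · obtain ⟨T, hT, hTorb⟩ := horb {b} (Set.finite_singleton b)
    have h1 : (⋃ t ∈ T, (fun c => t / c) '' (C : Set A)).Countable :=
      hT.biUnion fun t _ => hC.countable.image _
    refine h1.mono fun x hx => ?_
    obtain ⟨t, ht, k, hk, rfl⟩ := hTorb x
    have h2 := (hB _).1 hx k⁻¹ (by rw [inv_smul_eq_iff, hk b rfl])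
    rw [inv_smul_smul] at h2
    exact Set.mem_biUnion ht ⟨_, h2, by simp⟩
  · exact (hB b).2 fun k hk => by simp [hk, C.one_mem]
  · intro i x hx y hxy
    refine (hB y).2 fun k hk => mem_relClosure_of_rel ((hB x).1 hx k hk) (i := i) ?_
    exact (Γ i).div_mem (hinv i k _ _ hxy) hxy

end CountablyManyOrbits

/-! ## Orbits on sorts -/

section Sorts

variable {G X : Type*} [Group G] [MulAction G X]

/-- The quotient map `X ^ n → X ^ n / E`. -/
def InvRel.toElem (s : InvRel G X) (a : Fin s.n → X) : s.Elem := Quotient.mk s.rel a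

theorem InvRel.toElem_surjective (s : InvRel G X) : Function.Surjective s.toElem :=
  Quotient.mk_surjective

theorem InvRel.smul_toElem (s : InvRel G X) (g : G) (a : Fin s.n → X) :
    g • s.toElem a = s.toElem (g • a) := rfl

theorem InvRel.isQuotientMap_toElem [TopologicalSpace X] (s : InvRel G X) :
    Topology.IsQuotientMap s.toElem := isQuotientMap_quotient_mk'

instance [TopologicalSpace X] [ContinuousConstSMul G X] (s : InvRel G X) :
    ContinuousConstSMul G s.Elem where
  continuous_const_smul g := s.isQuotientMap_toElem.continuous_iff.2
    (s.isQuotientMap_toElem.continuous.comp (continuous_const_smul g))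

/-- Preimages of points are slices of the closed relation. For the topological group `A` this
separation already implies that it is Hausdorff. -/
theorem InvRel.IsTopSort.t1Space [TopologicalSpace X] {s : InvRel G X} (hs : s.IsTopSort) :
    T1Space s.Elem := by
  refine ⟨fun q => ?_⟩
  obtain ⟨a, rfl⟩ := s.toElem_surjective q
  rw [← s.isQuotientMap_toElem.isClosed_preimage]
  convert hs.preimage (f := fun b : Fin s.n → X => (b, a)) (by fun_prop)
  ext b
  exact Quotient.eq

/-- The coordinates of a representative support its class. -/
theorem InvRel.exists_finite_support_elem (s : InvRel G X) (q : s.Elem) :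
    ∃ D : Set X, D.Finite ∧ ∀ g ∈ fixingSubgroup G D, g • q = q := by
  obtain ⟨a, rfl⟩ := s.toElem_surjective q
  refine ⟨Set.range a, Set.finite_range a, fun g hg => congrArg s.toElem ?_⟩
  funext i
  exact (mem_fixingSubgroup_iff G).1 hg _ ⟨i, rfl⟩

/-- Pointwise stabilizers of finite sets of elements which have finite supports contain pointwise
stabilizers of finite sets of elements of `X`. -/
theorem exists_fixingSubgroup_le {Y : Type*} [MulAction G Y]
    (hY : ∀ y : Y, ∃ D : Set X, D.Finite ∧ ∀ g ∈ fixingSubgroup G D, g • y = y)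
    {F : Set Y} (hF : F.Finite) :
    ∃ D : Set X, D.Finite ∧ fixingSubgroup G D ≤ fixingSubgroup G F := by
  choose D hD h using hY
  refine ⟨⋃ y ∈ F, D y, hF.biUnion fun y _ => hD y, fun g hg => ?_⟩
  rw [mem_fixingSubgroup_iff]
  exact fun y hy => h y g (fixingSubgroup_antitone G X (Set.subset_biUnion_of_mem hy) hg)

theorem exists_fixingSubgroup_le_of_imaginary [TopologicalSpace G] {P : Set (Imaginary G X)}
    (hP : P.Finite) : ∃ D : Set X, D.Finite ∧ fixingSubgroup G D ≤ fixingSubgroup G P := by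
  refine exists_fixingSubgroup_le ?_ hP
  rintro ⟨s, q⟩
  obtain ⟨D, hD, h⟩ := s.1.exists_finite_support_elem q
  exact ⟨D, hD, fun g hg => congrArg (Sigma.mk s) (h g hg)⟩

/-- Let `d` enumerate `D`. An element of `G` carrying the concatenation of `d` and `x` to that of
`d` and `y` fixes `D` pointwise and carries `x` to `y`, so it suffices to count the orbits on a
larger power of `X`. -/
theorem IsSmall.exists_countable_representatives (hsmall : IsSmall G X) (s : InvRel G X)
    {D : Set X} (hD : D.Finite) : ∃ T : Set s.Elem, T.Countable ∧
      ∀ y, ∃ t ∈ T, ∃ g ∈ fixingSubgroup G D, g • t = y := by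
  obtain ⟨N, d, rfl⟩ : ∃ (N : ℕ) (d : Fin N → X), Set.range d = D := by
    have := hD.to_subtype
    obtain ⟨N, ⟨e⟩⟩ := Finite.exists_equiv_fin D
    exact ⟨N, fun i => e.symm i, by
      rw [Set.range_comp' Subtype.val, e.symm.surjective.range_eq, Set.image_univ,
        Subtype.range_coe]⟩
  have := hsmall (N + s.n)
  let cls (x : Fin s.n → X) : MulAction.orbitRel.Quotient G (Fin (N + s.n) → X) :=
    Quotient.mk _ (Fin.append d x)
  let r (q : Set.range cls) : Fin s.n → X := q.2.choose
  have hr (q : Set.range cls) : cls (r q) = q := q.2.choose_spec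
  refine ⟨Set.range fun q => s.toElem (r q), Set.countable_range _, ?_⟩
  intro y
  obtain ⟨x, rfl⟩ := s.toElem_surjective y
  refine ⟨_, ⟨⟨cls x, x, rfl⟩, rfl⟩, ?_⟩
  have h1 := hr ⟨cls x, x, rfl⟩
  obtain ⟨g, hg⟩ := MulAction.orbitRel_apply.1 (Quotient.exact h1.symm)
  have hg' (i) : g • Fin.append d (r ⟨cls x, x, rfl⟩) i = Fin.append d x i := congrFun hg i
  refine ⟨g, ?_, congrArg s.toElem ?_⟩
  · rw [mem_fixingSubgroup_iff]
    rintro _ ⟨i, rfl⟩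
    simpa using hg' (Fin.castAdd s.n i)
  · funext i
    simpa using hg' (Fin.natAdd N i)

end Sorts

/-! ## The action on an invariant subgroup -/

section Action

open scoped IsMulCommutative
open Topology

variable {G X : Type*} [Group G] [TopologicalSpace G] [TopologicalSpace X] [MulAction G X]
variable {s : InvRel G X} {H : Set s.Elem} [Group H] {A : Subgroup H} {K : Subgroup G}

/-- The image under `k` of an element of a subgroup invariant under `K`. -/
noncomputable def invariantSubgroupSMul (hA : IsClosedOver K (subgroupSet A)) (k : K) (a : A) : A :=
  ((isClosedOver_iff.1 hA).2 k k.2 _ (Set.mem_range_self a)).choose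

theorem coe_invariantSubgroupSMul (hA : IsClosedOver K (subgroupSet A)) (k : K) (a : A) :
    ((invariantSubgroupSMul hA k a : H) : s.Elem) = (k : G) • ((a : H) : s.Elem) :=
  ((isClosedOver_iff.1 hA).2 k k.2 _ (Set.mem_range_self a)).choose_spec

/-- If the multiplication of `H` and the set `A` are invariant under `K`, then `K` acts on `A` by
automorphisms. -/
noncomputable abbrev invariantSubgroupAction (hH : IsClosedOver K (mulGraph H))
    (hA : IsClosedOver K (subgroupSet A)) : MulDistribMulAction K A where
  smul := invariantSubgroupSMul hA
  one_smul a := Subtype.ext (Subtype.ext ((coe_invariantSubgroupSMul hA 1 a).trans (one_smul G _)))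
  mul_smul k l a := Subtype.ext (Subtype.ext (by
    refine (coe_invariantSubgroupSMul hA (k * l) a).trans ?_
    refine Eq.trans ?_ (coe_invariantSubgroupSMul hA k _).symm
    rw [Subgroup.coe_mul, mul_smul]
    exact congrArg ((k : G) • ·) (coe_invariantSubgroupSMul hA l a).symm))
  smul_mul k a b := by
    have h1 := (isClosedOver_iff.1 hH).2 k k.2 _ (mk_mem_mulGraph (a := (a : H)) (b := b).2 rfl)
    change (k.1 • ((a : H) : s.Elem), k.1 • ((b : H) : s.Elem), k.1 • (((a * b : A) : H) : s.Elem))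
      ∈ _ at h1
    rw [← coe_invariantSubgroupSMul hA, ← coe_invariantSubgroupSMul hA,
      ← coe_invariantSubgroupSMul hA, mk_mem_mulGraph] at h1
    exact (Subtype.ext (Subtype.ext h1)).symm
  smul_one k := by
    have h1 := (isClosedOver_iff.1 hH).2 k k.2 _ (idem_mem_mulGraph.2 rfl)
    exact Subtype.ext (Subtype.ext ((coe_invariantSubgroupSMul hA k 1).trans
      (idem_mem_mulGraph.1 h1)))

variable [IsMulCommutative A] [MulDistribMulAction K A]
  (hact : ∀ (k : K) (a : A), (((k • a : A) : H) : s.Elem) = (k : G) • ((a : H) : s.Elem))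

include hact

theorem continuousConstSMul_of_coe_smul [ContinuousConstSMul G X] : ContinuousConstSMul K A where
  continuous_const_smul k := by
    have h1 : IsEmbedding fun a : A => ((a : H) : s.Elem) :=
      IsEmbedding.subtypeVal.comp IsEmbedding.subtypeVal
    rw [h1.continuous_iff]
    have h2 := (continuous_const_smul (k : G)).comp h1.continuous
    exact h2.congr fun a => (hact k a).symm

theorem mem_iff_smul_mem_of_isClosedOver {Γ : Subgroup (A × A)} (hΓ : IsClosedOver K (relSet Γ))
    (k : K) (x y : A) (h : (x, y) ∈ Γ) : (k • x, k • y) ∈ Γ := by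
  rw [← mk_mem_relSet, hact, hact]
  exact (isClosedOver_iff.1 hΓ).2 k k.2 _ (mk_mem_relSet.2 h)

theorem hasCountablyManyOrbitsOverFinite (hsmall : IsSmall G X)
    (hK : ∃ D : Set X, D.Finite ∧ fixingSubgroup G D ≤ K) :
    HasCountablyManyOrbitsOverFinite K A := by
  intro F hF
  obtain ⟨D, hD, hDK⟩ := hK
  obtain ⟨D', hD', hDF⟩ := exists_fixingSubgroup_le (s.exists_finite_support_elem)
    (hF.image fun a : A => ((a : H) : s.Elem))
  obtain ⟨T, hT, hTorb⟩ := hsmall.exists_countable_representatives s (hD.union hD')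
  have hinj : Function.Injective fun a : A => ((a : H) : s.Elem) :=
    Subtype.val_injective.comp Subtype.val_injective
  refine ⟨_, hT.preimage hinj, fun x => ?_⟩
  obtain ⟨t, ht, g, hg, hgx⟩ := hTorb x
  have hgK : g ∈ K := hDK (fixingSubgroup_antitone G X Set.subset_union_left hg)
  have hgF := hDF (fixingSubgroup_antitone G X Set.subset_union_right hg)
  -- The representative `t` is a priori only in the sort. It lies in `A` because it equals `g⁻¹ • x`
  -- and `K` preserves `A`.
  refine ⟨(⟨g, hgK⟩ : K)⁻¹ • x, ?_, ⟨g, hgK⟩, fun e he => ?_, smul_inv_smul _ _⟩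
  · rw [Set.mem_preimage, hact, ← hgx]
    simpa using ht
  · apply hinj
    exact (hact _ _).trans ((mem_fixingSubgroup_iff G).1 hgF _ ⟨e, he, rfl⟩)

/-- Compactness makes the displacement small uniformly in `x` for `k` near `1`, and a second
countable group is covered by countably many translates of a neighbourhood of `1`. The compactness
argument takes place on the preimage of `A` in the power of `X`, where the action is jointly
continuous. -/
theorem isUniformlySeparable [CompactSpace X] [SecondCountableTopology G] [ContinuousSMul G X]
    [IsTopologicalGroup G] [IsTopologicalGroup A] (hA : IsClosed (subgroupSet A)) :
    IsUniformlySeparable K A := by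
  intro U hU
  have hZ : IsCompact (s.toElem ⁻¹' subgroupSet A) :=
    (hA.preimage s.isQuotientMap_toElem.continuous).isCompact
  have hZc := isCompact_iff_compactSpace.1 hZ
  let p (z : s.toElem ⁻¹' subgroupSet A) : A := z.2.choose
  have hp (z) : ((p z : H) : s.Elem) = s.toElem z := z.2.choose_spec
  have hemb : IsEmbedding fun a : A => ((a : H) : s.Elem) :=
    IsEmbedding.subtypeVal.comp IsEmbedding.subtypeVal
  have hpc : Continuous p := by
    rw [hemb.continuous_iff]
    exact (s.isQuotientMap_toElem.continuous.comp continuous_subtype_val).congr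
      fun z => (hp z).symm
  have hkp : Continuous fun q : K × (s.toElem ⁻¹' subgroupSet A) => q.1 • p q.2 := by
    rw [hemb.continuous_iff]
    have h1 : Continuous fun q : K × (s.toElem ⁻¹' subgroupSet A) =>
        s.toElem ((q.1 : G) • (q.2 : Fin s.n → X)) :=
      s.isQuotientMap_toElem.continuous.comp (by fun_prop)
    refine h1.congr fun q => ?_
    rw [Function.comp_apply, hact, hp, s.smul_toElem]
  have hW : ∀ᶠ k : K in 𝓝 1, ∀ z ∈ Set.univ, k • p z / p z ∈ U := by
    refine isCompact_univ.eventually_forall_of_forall_eventually fun z _ => ?_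
    have h1 : Continuous fun q : K × (s.toElem ⁻¹' subgroupSet A) => q.1 • p q.2 / p q.2 :=
      hkp.div' (hpc.comp continuous_snd)
    exact h1.continuousAt (by simpa using hU)
  have hW' : {w : K | ∀ x : A, w • x / x ∈ U} ∈ 𝓝 (1 : K) := by
    filter_upwards [hW] with k hk x
    obtain ⟨z, hz⟩ := s.toElem_surjective ((x : H) : s.Elem)
    have h1 : z ∈ s.toElem ⁻¹' subgroupSet A := ⟨x, hz.symm⟩
    have h2 : p ⟨z, h1⟩ = x := hemb.injective ((hp ⟨z, h1⟩).trans hz)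
    exact h2 ▸ hk ⟨z, h1⟩ trivial
  have : SecondCountableTopology K :=
    TopologicalSpace.Subtype.secondCountableTopology (K : Set G)
  obtain ⟨T, hT, hTK⟩ := TopologicalSpace.countable_cover_nhds
    (f := fun t : K => (fun k => t⁻¹ * k) ⁻¹' {w : K | ∀ x : A, w • x / x ∈ U}) (fun t =>
      (continuous_const_mul t⁻¹).continuousAt (by simpa using hW'))
  refine ⟨T, hT, fun k => ?_⟩
  obtain ⟨t, ht, hk⟩ := Set.mem_iUnion₂.1 (hTK.ge (Set.mem_univ k))
  exact ⟨t, ht, t⁻¹ * k, hk, by simp⟩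

/-- A closed `K`-invariant subgroup of `A` is `P`-closed, so minimality applies to it. -/
theorem IsMinimalSubgroup.finite_or_finiteIndex (hA : IsMinimalSubgroup A)
    (hcl : IsClosed (subgroupSet A)) {P : Set (Imaginary G X)} (hP : P.Finite)
    (hPK : fixingSubgroup G P ≤ K) {B : Subgroup A}
    (hB : IsClosed (B : Set A)) (hinv : ∀ (k : K), ∀ x ∈ B, k • x ∈ B) :
    (B : Set A).Finite ∨ B.FiniteIndex := by
  have hcoe (x : A) : ((x : H) : s.Elem) ∈ subgroupSet (B.map A.subtype) ↔ x ∈ B := by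
    rw [coe_mem_subgroupSet]
    simp
  have h1 : IsStarClosed G X (subgroupSet (B.map A.subtype)) := by
    refine ⟨P, hP, isClosedOver_iff.2 ⟨?_, ?_⟩⟩
    · have hemb : IsClosedEmbedding fun a : A => ((a : H) : s.Elem) :=
        ⟨IsEmbedding.subtypeVal.comp IsEmbedding.subtypeVal, hcl⟩
      convert hemb.isClosedMap _ hB
      ext t
      constructor
      · rintro ⟨⟨_, a, ha, rfl⟩, rfl⟩
        exact ⟨a, ha, rfl⟩
      · rintro ⟨a, ha, rfl⟩
        exact (hcoe a).2 ha
    · rintro g hg _ ⟨⟨_, a, ha, rfl⟩, rfl⟩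
      have h2 := (hcoe _).2 (hinv ⟨g, hPK hg⟩ a ha)
      rwa [hact] at h2
  by_cases h2 : (B.map A.subtype).IsFiniteRelIndex A
  · right
    rwa [Subgroup.isFiniteRelIndex_iff_finiteIndex, Subgroup.subgroupOf,
      Subgroup.comap_map_eq_self_of_injective A.subtype_injective] at h2
  · left
    have h3 := hA.finite_of_infinite_index _ (Subgroup.map_subtype_le _) h1 h2
    have h4 : Finite B := Finite.of_equiv _
      (B.equivMapOfInjective A.subtype A.subtype_injective).symm.toEquiv
    exact Set.toFinite (B : Set A)

end Action

/-! ## Local finiteness -/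

section AdaptedRelations

variable {K A : Type*} [Group K] [CommGroup A] [MulDistribMulAction K A] {D B : Subgroup A}

variable (K D B) in
/-- The relation `Γ` is invariant under `K`, everywhere defined on `D` with some value in `D`, and
all its values at elements of `B` belong to `B`. -/
structure IsAdaptedRel (Γ : Subgroup (A × A)) : Prop where
  smul_mem : ∀ (k : K) (x y : A), (x, y) ∈ Γ → (k • x, k • y) ∈ Γ
  total : ∀ x ∈ D, ∃ y ∈ D, (x, y) ∈ Γ
  mem_of_mem : ∀ x ∈ B, ∀ y, (x, y) ∈ Γ → y ∈ B

/-- Adaptedness passes through the ring operations, so it propagates from generators to the whole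
subring; plain quasi-endomorphisms could lose the chosen point from their domain. -/
theorem IsAdaptedRel.relComp {Γ Δ : Subgroup (A × A)} (hΓ : IsAdaptedRel K D B Γ)
    (hΔ : IsAdaptedRel K D B Δ) : IsAdaptedRel K D B (relComp Γ Δ) where
  smul_mem k _ _ := fun ⟨z, h1, h2⟩ => ⟨k • z, hΔ.smul_mem k _ _ h1, hΓ.smul_mem k _ _ h2⟩
  total x hx := by
    obtain ⟨y, hy, h1⟩ := hΔ.total x hx
    obtain ⟨z, hz, h2⟩ := hΓ.total y hy
    exact ⟨z, hz, y, h1, h2⟩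
  mem_of_mem x hx y := fun ⟨z, h1, h2⟩ => hΓ.mem_of_mem z (hΔ.mem_of_mem x hx z h1) y h2

theorem IsAdaptedRel.relAdd {Γ Δ : Subgroup (A × A)} (hΓ : IsAdaptedRel K D B Γ)
    (hΔ : IsAdaptedRel K D B Δ) : IsAdaptedRel K D B (relAdd Γ Δ) where
  smul_mem k _ _ := fun ⟨u, v, h1, h2, h3⟩ =>
    ⟨k • u, k • v, hΓ.smul_mem k _ _ h1, hΔ.smul_mem k _ _ h2, by
      rw [← smul_mul']
      exact congrArg (k • ·) h3⟩
  total x hx := by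
    obtain ⟨u, hu, h1⟩ := hΓ.total x hx
    obtain ⟨v, hv, h2⟩ := hΔ.total x hx
    exact ⟨u * v, D.mul_mem hu hv, u, v, h1, h2, rfl⟩
  mem_of_mem x hx y := fun ⟨u, v, h1, h2, h3⟩ => by
    rw [show y = u * v from h3.symm]
    exact B.mul_mem (hΓ.mem_of_mem x hx u h1) (hΔ.mem_of_mem x hx v h2)

theorem IsAdaptedRel.relNeg {Γ : Subgroup (A × A)} (hΓ : IsAdaptedRel K D B Γ) :
    IsAdaptedRel K D B (relNeg Γ) where
  smul_mem k x y h := by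
    have := hΓ.smul_mem k _ _ (mem_relNeg.1 h)
    rw [smul_inv'] at this
    exact this
  total x hx := by
    obtain ⟨u, hu, h1⟩ := hΓ.total x hx
    exact ⟨u⁻¹, D.inv_mem hu, by simpa [mem_relNeg] using h1⟩
  mem_of_mem x hx y h := by simpa using hΓ.mem_of_mem x hx _ (mem_relNeg.1 h)

variable (K D B) in
theorem isAdaptedRel_relZero : IsAdaptedRel K D B (relZero A) where
  smul_mem k x y h := by
    rw [show y = 1 from h, smul_one]
    rfl
  total _ _ := ⟨1, D.one_mem, rfl⟩
  mem_of_mem _ _ y h := by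
    rw [show y = 1 from h]
    exact B.one_mem

variable (K D B) in
theorem isAdaptedRel_relOne : IsAdaptedRel K D B (relOne A) where
  smul_mem k _ _ h := congrArg (k • ·) h
  total x hx := ⟨x, hx, rfl⟩
  mem_of_mem _ hx y h := by
    rw [← show _ = y from h]
    exact hx

/-- This set is a union of countably many finite orbits. Hence an uncountable subgroup contains a
point with infinite orbit. -/
theorem HasCountablyManyOrbitsOverFinite.countable_finite_orbits
    (horb : HasCountablyManyOrbitsOverFinite K A) :
    {x : A | (MulAction.orbit K x).Finite}.Countable := by
  obtain ⟨T, hT, hTorb⟩ := horb ∅ Set.finite_empty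
  have h1 : (⋃ t ∈ T ∩ {x : A | (MulAction.orbit K x).Finite}, MulAction.orbit K t).Countable :=
    (hT.mono Set.inter_subset_left).biUnion fun t ht => ht.2.countable
  refine h1.mono fun x hx => ?_
  obtain ⟨t, ht, k, -, rfl⟩ := hTorb x
  refine Set.mem_biUnion ⟨ht, ?_⟩ ⟨k, rfl⟩
  have h2 : (MulAction.orbit K (k • t)).Finite := hx
  rwa [MulAction.orbit_smul] at h2

end AdaptedRelations

/-! ### Finiteness of finitely generated subrings -/

section LocallyFinite

open scoped IsMulCommutative

variable {G X : Type*} [Group G] [TopologicalSpace G] [IsTopologicalGroup G]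
  [SecondCountableTopology G] [TopologicalSpace X] [CompactSpace X] [MulAction G X]
  [ContinuousSMul G X] {s : InvRel G X} {H : Set s.Elem} [Group H] {A : Subgroup H}
  [IsMulCommutative A]

theorem autogenyRing_finite_closure (hsmall : IsSmall G X) (hs : s.IsTopSort)
    (hH : IsStarClosedGroup H) (hA : IsMinimalSubgroup A) {S : Set (AutogenyRing hH hA)}
    (hS : S.Finite) : (Subring.closure S : Set (AutogenyRing hH hA)).Finite := by
  have := hs.t1Space
  have := compactSpace_of_isStarClosed hA.isStarClosed
  have := isTopologicalGroup_of_isStarClosed hH hA.isStarClosed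
  have := hA.infinite
  have hunc : Uncountable A := by
    rw [← not_countable_iff]
    intro h
    have := finite_of_countable_of_compactSpace (A := A)
    exact not_finite A
  have := hS.to_subtype
  obtain ⟨P₁, hP₁, hmul⟩ := hH.2
  obtain ⟨P₂, hP₂, hAcl⟩ := hA.isStarClosed
  choose Γ hΓ hΓstar hΓmk using fun r : S => r.1.2
  choose P hP hΓcl using hΓstar
  -- Parameters for the multiplication, for `A` and for representatives of all generators together.
  let Q : Set (Imaginary G X) := P₁ ∪ P₂ ∪ ⋃ r, P r
  have hQ : Q.Finite := (hP₁.union hP₂).union (Set.finite_iUnion hP)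
  set K := fixingSubgroup G Q
  replace hmul : IsClosedOver K (mulGraph H) := hmul.mono
    (fixingSubgroup_antitone G _ (Set.subset_union_left.trans Set.subset_union_left))
  replace hAcl : IsClosedOver K (subgroupSet A) := hAcl.mono
    (fixingSubgroup_antitone G _ (Set.subset_union_right.trans Set.subset_union_left))
  replace hΓcl (r : S) : IsClosedOver K (relSet (Γ r)) := (hΓcl r).mono
    (fixingSubgroup_antitone G _ ((Set.subset_iUnion P r).trans Set.subset_union_right))
  let _ : MulDistribMulAction K A := invariantSubgroupAction hmul hAcl
  have hact (k : K) (a : A) : (((k • a : A) : H) : s.Elem) = (k : G) • ((a : H) : s.Elem) :=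
    coe_invariantSubgroupSMul hAcl k a
  have := continuousConstSMul_of_coe_smul hact
  have horb := hasCountablyManyOrbitsOverFinite hact hsmall
    (exists_fixingSubgroup_le_of_imaginary hQ)
  have hinv (r : S) := mem_iff_smul_mem_of_isClosedOver hact (hΓcl r)
  obtain ⟨D, hD, hDtot⟩ := exists_uncountable_subgroup_total horb hΓ hinv
  have hC := finite_relClosure horb (isUniformlySeparable hact hAcl.1)
    (fun B hB hB' => hA.finite_or_finiteIndex hact hAcl.1 hQ le_rfl hB hB')
    (fun r => (hΓ r).indet) hinv
  obtain ⟨b, hbD, hb⟩ : ∃ b ∈ D, ¬ (MulAction.orbit K b).Finite := by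
    by_contra! h
    exact hD (horb.countable_finite_orbits.mono h)
  obtain ⟨B, hB, hbB, hBcl⟩ := exists_finite_subgroup_closed_under_rel horb hinv hC b
  have hrep : ∀ r ∈ Subring.closure S, ∃ (Γ : Subgroup (A × A)) (hΓ : IsQuasiEnd Γ),
      IsStarClosed G X (relSet Γ) ∧ IsAdaptedRel K D B Γ ∧ r.1 = QuasiEndRing.mk Γ hΓ := by
    intro r hr
    induction hr using Subring.closure_induction with
    | mem r hr => exact ⟨Γ ⟨r, hr⟩, hΓ ⟨r, hr⟩, ⟨Q, hQ, hΓcl ⟨r, hr⟩⟩, ⟨hinv ⟨r, hr⟩,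
        fun x hx => hDtot x hx ⟨r, hr⟩, hBcl ⟨r, hr⟩⟩, hΓmk ⟨r, hr⟩⟩
    | zero => exact ⟨_, isQuasiEnd_relZero A, isStarClosed_relZero hH hA.isStarClosed,
        isAdaptedRel_relZero K D B, rfl⟩
    | one => exact ⟨_, isQuasiEnd_relOne A, isStarClosed_relOne hH hA.isStarClosed,
        isAdaptedRel_relOne K D B, rfl⟩
    | add r r' _ _ h h' =>
      obtain ⟨Γ, h1, h2, h3, h4⟩ := h
      obtain ⟨Γ', h1', h2', h3', h4'⟩ := h'
      exact ⟨_, h1.relAdd h1', isStarClosed_relAdd hH h2 h2', h3.relAdd h3',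
        congrArg₂ (· + ·) h4 h4'⟩
    | neg r _ h =>
      obtain ⟨Γ, h1, h2, h3, h4⟩ := h
      exact ⟨_, h1.relNeg, isStarClosed_relNeg hH h2, h3.relNeg, congrArg (- ·) h4⟩
    | mul r r' _ _ h h' =>
      obtain ⟨Γ, h1, h2, h3, h4⟩ := h
      obtain ⟨Γ', h1', h2', h3', h4'⟩ := h'
      exact ⟨_, h1.relComp h1', isStarClosed_relComp h2 h2', h3.relComp h3',
        congrArg₂ (· * ·) h4 h4'⟩
  choose Θ hΘ hΘstar hΘad hΘmk using fun r : Subring.closure S => hrep r.1 r.2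
  choose v hvD hv using fun r => (hΘad r).total b hbD
  have hvB (r) : v r ∈ (B : Set A) := (hΘad r).mem_of_mem b hbB _ (hv r)
  -- Evaluation at `b` is injective: if two values agree, `b` lies in the kernel of the difference,
  -- and so does its infinite `K`-orbit, which is impossible for a nonzero class.
  have hinj : Function.Injective fun r => (⟨v r, hvB r⟩ : (B : Set A)) := by
    intro r r' hrr'
    have hvv : v r = v r' := congrArg Subtype.val hrr'
    by_contra hne
    have h0 : QuasiEndRing.mk _ ((hΘ r).relAdd (hΘ r').relNeg) ≠ 0 := by
      intro h
      refine hne (Subtype.ext (Subtype.ext (sub_eq_zero.1 ?_)))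
      rw [sub_eq_add_neg, hΘmk, hΘmk]
      exact h
    have h1 := (finite_ker_of_ne_zero hH hA _
      (isStarClosed_relAdd hH (hΘstar r) (isStarClosed_relNeg hH (hΘstar r'))) h0).indet
    have h2 : (b, (1 : A)) ∈ relAdd (Θ r) (relNeg (Θ r')) :=
      ⟨v r, (v r')⁻¹, hv r, by simpa [mem_relNeg] using hv r', by simp [hvv]⟩
    refine hb (h1.subset ?_)
    rintro _ ⟨k, rfl⟩
    have h3 := ((hΘad r).relAdd (hΘad r').relNeg).smul_mem k _ _ h2
    rwa [smul_one] at h3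
  have := hB.to_subtype
  have := Finite.of_injective _ hinj
  exact Set.toFinite _

end LocallyFinite

/-! ## Conjugates of virtual autogenies -/

section LocallyFiniteDomains

variable {R : Type*} [Ring R] [IsDomain R]

/-- Two elements generate a finite domain, which is a field by Wedderburn's little theorem. -/
theorem mul_comm_of_locallyFinite
    (hR : ∀ S : Set R, S.Finite → (Subring.closure S : Set R).Finite) (x y : R) :
    x * y = y * x := by
  have : Finite (Subring.closure {x, y}) := (hR {x, y} (Set.toFinite _)).to_subtype
  have h1 := Finite.isDomain_to_isField (Subring.closure {x, y})
  have hx : x ∈ Subring.closure {x, y} := Subring.subset_closure (by simp)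
  have hy : y ∈ Subring.closure {x, y} := Subring.subset_closure (by simp)
  exact congrArg Subtype.val (h1.mul_comm ⟨x, hx⟩ ⟨y, hy⟩)

/-- The powers of `x` all lie in the finite subring generated by `x`. -/
theorem exists_pow_eq_pow_of_locallyFinite
    (hR : ∀ S : Set R, S.Finite → (Subring.closure S : Set R).Finite) (x : R) :
    ∃ m n : ℕ, m < n ∧ x ^ m = x ^ n := by
  have h1 := hR {x} (Set.finite_singleton x)
  have hx : x ∈ Subring.closure {x} := Subring.subset_closure rfl
  obtain ⟨m, -, n, -, hmn, h⟩ := Set.infinite_univ.exists_lt_map_eq_of_mapsTo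
    (f := fun n : ℕ => x ^ n) (fun n _ => pow_mem hx n) h1
  exact ⟨m, n, hmn, h⟩

/-- These are roots of the nonzero polynomial `X ^ m - X ^ n` over a commutative domain. -/
theorem finite_setOf_pow_eq_pow (hcomm : ∀ x y : R, x * y = y * x) {m n : ℕ} (hmn : m < n) :
    {x : R | x ^ m = x ^ n}.Finite := by
  let _ : CommRing R := { ‹Ring R› with mul_comm := hcomm }
  have h1 : (Polynomial.X ^ m - Polynomial.X ^ n : Polynomial R) ≠ 0 := by
    intro h
    have h2 := congrArg (Polynomial.coeff · n) h
    simp [Polynomial.coeff_X_pow, hmn.ne'] at h2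
  refine (Polynomial.finite_setOfPred_isRoot h1).subset fun x hx => ?_
  have hx' : x ^ m = x ^ n := hx
  simp [hx']

end LocallyFiniteDomains

/-! ### Automorphisms acting on quasi-endomorphisms -/

section Conjugation

variable {A : Type*} [CommGroup A]

/-- The image of a relation under an automorphism. -/
def relConj (φ : A ≃* A) (Γ : Subgroup (A × A)) : Subgroup (A × A) :=
  Γ.comap (MonoidHom.prodMap φ.symm.toMonoidHom φ.symm.toMonoidHom)

theorem mem_relConj {φ : A ≃* A} {Γ : Subgroup (A × A)} {p : A × A} :
    p ∈ relConj φ Γ ↔ (φ.symm p.1, φ.symm p.2) ∈ Γ := Iff.rfl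

theorem IsQuasiEnd.relConj {Γ : Subgroup (A × A)} (hΓ : IsQuasiEnd Γ) (φ : A ≃* A) :
    IsQuasiEnd (relConj φ Γ) := by
  constructor
  · have := hΓ.dom
    have h1 : ((_root_.relConj φ Γ).map (MonoidHom.fst A A)) =
        (Γ.map (MonoidHom.fst A A)).comap φ.symm.toMonoidHom := by
      ext x
      rw [Subgroup.mem_comap, mem_dom, mem_dom]
      exact ⟨fun ⟨y, hy⟩ => ⟨_, hy⟩, fun ⟨y, hy⟩ => ⟨φ y, by simpa [mem_relConj] using hy⟩⟩
    rw [h1]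
    exact ⟨by
      rw [Subgroup.index_comap_of_surjective _ φ.symm.surjective]
      exact this.index_ne_zero⟩
  · refine (hΓ.indet.image φ).subset fun y hy => ⟨φ.symm y, ?_, by simp⟩
    simpa [mem_relConj] using hy

/-- An automorphism of `A` acts multiplicatively on the ring of quasi-endomorphisms of `A`. -/
def QuasiEndRing.conj (φ : A ≃* A) : QuasiEndRing A →* QuasiEndRing A where
  toFun := Quotient.map (fun Γ => ⟨relConj φ Γ.1, Γ.2.relConj φ⟩) fun Γ Δ h =>
    commensurable_of_le ((Γ.2.inf h).relConj φ).dom (Γ.2.relConj φ) (Δ.2.relConj φ)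
      (fun _ hp => hp.1) (fun _ hp => hp.2)
  map_one' := mk_congr fun _ => φ.symm.injective.eq_iff
  map_mul' r r' := by
    induction r using QuasiEndRing.ind with | h Γ hΓ =>
    induction r' using QuasiEndRing.ind with | h Δ hΔ =>
    refine mk_congr (hΓ := (hΓ.relComp hΔ).relConj φ)
      (hΔ := (hΓ.relConj φ).relComp (hΔ.relConj φ)) fun p => ⟨?_, ?_⟩
    · rintro ⟨y, h1, h2⟩
      exact ⟨φ y, by simpa [mem_relConj] using h1, by simpa [mem_relConj] using h2⟩
    · rintro ⟨y, h1, h2⟩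
      exact ⟨φ.symm y, h1, h2⟩

end Conjugation

/-! ### Classes of the conjugates of a virtual autogeny -/

section Conjugates

open scoped IsMulCommutative

variable {G X : Type*} [Group G] [MulAction G X]

/-- Two elements carrying `a` to the same point differ by an element of the stabilizer of `a`, which
preserves `S`. -/
theorem conjugateSet_smul {Y α : Type*} [MulAction G Y] [MulAction G α] {S : Set Y} {a : α}
    (hS : ∀ g ∈ MulAction.stabilizer G a, g • S = S) (g : G) :
    conjugateSet (G := G) S a (g • a) = g • S := by
  ext y
  constructor
  · rintro ⟨g', hg', hy⟩
    have h1 := hS (g⁻¹ * g') (by rw [MulAction.mem_stabilizer_iff, mul_smul, hg', inv_smul_smul])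
    rw [mul_smul, inv_smul_eq_iff] at h1
    rwa [h1] at hy
  · exact fun hy => ⟨g, rfl, hy⟩

/-- Translating by `g` moves the parameters to `g • P`, whose pointwise stabilizer is the conjugate
by `g` of that of `P`. -/
theorem IsStarClosed.smul [TopologicalSpace G] {Y : Type*} [TopologicalSpace Y] [MulAction G Y]
    [ContinuousConstSMul G Y] {S : Set Y} (hS : IsStarClosed G X S) (g : G) :
    IsStarClosed G X (g • S) := by
  obtain ⟨P, hP, hS, hinv⟩ := hS
  refine ⟨g • P, hP.smul_set, hS.smul g, fun h hh => ?_⟩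
  have h1 : g⁻¹ * h * g ∈ fixingSubgroup G P := by
    rw [mem_fixingSubgroup_iff] at hh ⊢
    intro p hp
    rw [mul_smul, mul_smul, hh _ (Set.smul_mem_smul_set hp), inv_smul_smul]
  have h2 := hinv _ h1
  rwa [mul_smul, mul_smul, inv_smul_eq_iff] at h2

variable [TopologicalSpace G] [TopologicalSpace X] {s : InvRel G X} {H : Set s.Elem} [Group H]
  {A : Subgroup H} {K : Subgroup G} [IsMulCommutative A] [MulDistribMulAction K A]

theorem relSet_relConj
    (hact : ∀ (k : K) (a : A), (((k • a : A) : H) : s.Elem) = (k : G) • ((a : H) : s.Elem))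
    (Γ : Subgroup (A × A)) (k : K) :
    relSet (relConj (MulDistribMulAction.toMulEquiv A k) Γ) = (k : G) • relSet Γ := by
  ext ⟨t, u⟩
  constructor
  · rintro ⟨⟨x, y⟩, h, h'⟩
    obtain ⟨rfl, rfl⟩ := Prod.mk.inj h'
    refine ⟨_, mk_mem_relSet.2 (mem_relConj.1 h), ?_⟩
    dsimp only
    rw [Prod.smul_mk, ← hact, ← hact]
    exact Prod.ext (congrArg (fun z : A => ((z : H) : s.Elem)) (smul_inv_smul k x))
      (congrArg (fun z : A => ((z : H) : s.Elem)) (smul_inv_smul k y))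
  · rintro ⟨_, ⟨⟨x, y⟩, h, rfl⟩, h'⟩
    obtain ⟨rfl, rfl⟩ := Prod.mk.inj h'
    rw [← hact, ← hact, mk_mem_relSet, mem_relConj]
    have h1 : (k⁻¹ • k • x, k⁻¹ • k • y) ∈ Γ := by rwa [inv_smul_smul, inv_smul_smul]
    exact h1

theorem VirtualIsogeny.exists_graph_eq_relConj [CompactSpace X] [ContinuousConstSMul G X]
    (hact : ∀ (k : K) (a : A), (((k • a : A) : H) : s.Elem) = (k : G) • ((a : H) : s.Elem))
    (hH : IsStarClosedGroup H) (hA : IsMinimalSubgroup A) (f : VirtualAutogeny A) (k : K) :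
    ∃ f' : VirtualAutogeny A,
      f'.graph = relConj (MulDistribMulAction.toMulEquiv A k) f.graph := by
  obtain ⟨h1, h2⟩ := f.isQuasiEnd_graph hH hA
  -- The converse of the conjugate relation is, by definition, the conjugate of the converse, so
  -- `h2` serves for it.
  refine exists_virtualAutogeny_of_graph hH hA (h1.relConj _) (h2.relConj _) ?_
  rw [relSet_relConj hact]
  exact f.isStarClosed.smul (k : G)

/-- The conjugates of a virtual autogeny fall into finitely many classes, if the ring is locally
finite. -/
theorem finite_quotient_conjugatesEquivalent [CompactSpace X] [ContinuousConstSMul G X]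
    (hact : ∀ (k : K) (a : A), (((k • a : A) : H) : s.Elem) = (k : G) • ((a : H) : s.Elem))
    (hH : IsStarClosedGroup H) (hA : IsMinimalSubgroup A)
    (hR : ∀ S : Set (AutogenyRing hH hA), S.Finite →
      (Subring.closure S : Set (AutogenyRing hH hA)).Finite)
    {n : ℕ} {a : Fin n → X} {f : VirtualAutogeny A}
    (hf : IsClosedOver (MulAction.stabilizer G a) (relSet f.graph)) :
    ∃ E : Setoid (MulAction.orbit K a),
      (∀ x y, E x y ↔ ConjugatesEquivalent f a x.1 y.1) ∧ Finite (Quotient E) := by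
  choose k hk using fun x : MulAction.orbit K a => x.2
  choose c hc using fun x => f.exists_graph_eq_relConj hact hH hA (k x)
  have hconj (x : MulAction.orbit K a) :
      relSet (c x).graph = conjugateSet (G := G) (relSet f.graph) a x := by
    rw [hc, relSet_relConj hact, ← conjugateSet_smul hf.2]
    exact congrArg _ (hk x)
  let F (x : MulAction.orbit K a) : AutogenyRing hH hA := (c x).toRing hH hA
  refine ⟨Setoid.ker F, fun x y => ?_, ?_⟩
  · refine Iff.trans (VirtualIsogeny.toRing_eq_iff hH hA _ _)
      ⟨fun h => ⟨c x, c y, hconj x, hconj y, h⟩, ?_⟩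
    rintro ⟨f₁, f₂, h1, h2, h⟩
    -- A relation is determined by its underlying set, so `f₁` and `f₂` have the same graphs as the
    -- chosen conjugates `c x` and `c y`.
    unfold VirtualIsogeny.Equivalent at h ⊢
    rwa [relSet_injective (h1.trans (hconj x).symm),
      relSet_injective (h2.trans (hconj y).symm)] at h
  · obtain ⟨p, q, hpq, hfpq⟩ := exists_pow_eq_pow_of_locallyFinite hR (f.toRing hH hA)
    -- Every class `F x` is the image of the class of `f` under a multiplicative map, so it inherits
    -- the equation satisfied by `f`. Additivity of conjugation is not needed.
    have h1 : Set.range F ⊆ {r | r ^ p = r ^ q} := by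
      rintro _ ⟨x, rfl⟩
      have h2 : (F x).1 =
          QuasiEndRing.conj (MulDistribMulAction.toMulEquiv A (k x)) (f.toRing hH hA).1 :=
        QuasiEndRing.mk_congr fun p => by rw [hc]
      refine Subtype.ext ?_
      rw [SubmonoidClass.coe_pow, SubmonoidClass.coe_pow, h2, ← map_pow, ← map_pow]
      exact congrArg _ (congrArg Subtype.val hfpq)
    have := ((finite_setOf_pow_eq_pow (mul_comm_of_locallyFinite hR) hpq).subset h1).to_subtype
    exact Finite.of_equiv _ (Setoid.quotientKerEquivRange F).symm

end Conjugates

theorem lemma2p7 {G X : Type*} [Group G] [TopologicalSpace G] [IsTopologicalGroup G]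
    [PolishSpace G] [TopologicalSpace X] [CompactSpace X] [T2Space X] [MulAction G X]
    [FaithfulSMul G X] [ContinuousSMul G X] (hsmall : IsSmall G X)
    (s : InvRel G X) (hs : s.IsTopSort) (H : Set s.Elem) [Group H] (hH : IsStarClosedGroup H)
    (A : Subgroup H) [IsMulCommutative A] (hA : IsMinimalSubgroup A) :
    (∀ S : Set (AutogenyRing hH hA), S.Finite →
      (Subring.closure S : Set (AutogenyRing hH hA)).Finite) ∧
    (∀ P : Set (Imaginary G X), P.Finite →
      IsClosedGroupOver (fixingSubgroup G P) H →
      IsClosedOver (fixingSubgroup G P) (subgroupSet A) →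
      ∀ (n : ℕ) (a : Fin n → X) (f : VirtualAutogeny A),
        IsClosedOver (MulAction.stabilizer G a) (relSet f.graph) →
        ∃ E : Setoid (MulAction.orbit (fixingSubgroup G P) a),
          (∀ x y, E x y ↔ ConjugatesEquivalent f a x.1 y.1) ∧ Finite (Quotient E)) := by
  have hR (S : Set (AutogenyRing hH hA)) (hS : S.Finite) :=
    autogenyRing_finite_closure hsmall hs hH hA hS
  refine ⟨hR, fun P _ hHP hAP n a f hf => ?_⟩
  let _ := invariantSubgroupAction hHP.2 hAP
  exact finite_quotient_conjugatesEquivalent (coe_invariantSubgroupSMul hAP) hH hA hR hf
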